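/- Let $M$ be an $n$-dimensional, connected, paracompact Hausdorff manifold of class $C^{2,1}$ (the coordinate changes are $C^2$ with locally Lipschitz second derivatives), endowed with a locally Lipschitz spray: in every chart a locally Lipschitz function $H(x,v)$, $v\in\mathbb{R}^n$, with $H(x,sv)=s^2H(x,v)$ for all $s>0$, these functions being related under changes of chart in such a way that the system $\dot x=v$, $\dot v=H(x,v)$ does not depend on the chart. For $v\in TM$ let $\gamma_v$ be the solution which starts at $\pi(v)$ with velocity $v$, let $\Omega\subset TM$ be the set of those $v$ for which $\gamma_v$ exists at least on $[0,1]$, and let $\exp\colon\Omega\to M\times M$, $\exp v=(\pi(v),\gamma_v(1))$. For $p\in M$ let $\Omega_p=\Omega\cap T_pM$ and $\exp_p\colon\Omega_p\to M$, $\exp_p v=\gamma_v(1)$. Call a map strongly differentiable at a point $q$ if, in charts, there is a linear map $L$ with $|f(q_1)-f(q_2)-L(q_1-q_2)|\le\epsilon|q_1-q_2|$ for all $q_1,q_2$ sufficiently close to $q$, for every $\epsilon>0$; a Lipeomorphism is a homeomorphism which is locally Lipschitz together with its inverse. Then: ($\exp$) The set $\Omega$ is open in $TM$ and $\exp\colon\Omega\to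 M\times M$ is locally Lipschitz. Moreover, $\exp$ is strongly differentiable at every point $0_p$, $p\in M$, of the zero section, and there is an open neighbourhood $N\subset\Omega$ of the zero section, star-shaped in the sense that $sv\in N$ whenever $v\in N$ and $s\in[0,1]$, such that $\exp$ restricts to a Lipeomorphism of $N$ onto an open neighbourhood of the diagonal of $M\times M$. ($\exp_p$) For every $p\in M$ the set $\Omega_p$ is open in $T_pM$, and $\exp_p\colon\Omega_p\to M$ is locally Lipschitz and strongly differentiable at the origin. Moreover, there is an open neighbourhood $N_p\subset\Omega_p$ of the origin, star-shaped with respect to the origin, such that $\exp_p$ restricts to a Lipeomorphism of $N_p$ onto an open neighbourhood of $p$. -/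

import Mathlib

open Set Filter Topology Manifold
open scoped NNReal ContDiff

/-! ### Maps between manifolds, read in charts -/

section ChartNotions

variable {F G : Type*} [NormedAddCommGroup F] [NormedSpace ℝ F]
  [NormedAddCommGroup G] [NormedSpace ℝ G]
  {A B : Type*} [TopologicalSpace A] [TopologicalSpace B]
  {X Y : Type*} [TopologicalSpace X] [ChartedSpace A X] [TopologicalSpace Y] [ChartedSpace B Y]

/-- `f` is locally Lipschitz on `s`: it is continuous on `s` and around each point of `s` its
expression in charts is Lipschitz.  (On manifolds whose coordinate changes are `C¹` this does not
depend on the charts.) -/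
def LocallyLipschitzInCharts (I : ModelWithCorners ℝ F A) (J : ModelWithCorners ℝ G B)
    (f : X → Y) (s : Set X) : Prop :=
  ContinuousOn f s ∧ ∀ x ∈ s, ∃ K : ℝ≥0,
    ∃ t ∈ 𝓝[(extChartAt I x).symm ⁻¹' s ∩ range I] (extChartAt I x x),
      LipschitzOnWith K (writtenInExtChartAt I J x f) t

/-- `f` is strongly (strictly) differentiable at the point `x` (of a manifold without boundary):
it is continuous at `x` and its expression in charts has a strong differential. -/
def StronglyDifferentiableInCharts (I : ModelWithCorners ℝ F A) (J : ModelWithCorners ℝ G B)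
    (f : X → Y) (x : X) : Prop :=
  ContinuousAt f x ∧ ∃ L : F →L[ℝ] G,
    HasStrictFDerivAt (writtenInExtChartAt I J x f) L (extChartAt I x x)

/-- `f` restricts to a Lipeomorphism of `s` onto `t`: a homeomorphism of `s` onto `t` which is
locally Lipschitz together with its inverse. -/
def IsLipeomorphismOn (I : ModelWithCorners ℝ F A) (J : ModelWithCorners ℝ G B)
    (f : X → Y) (s : Set X) (t : Set Y) : Prop :=
  LocallyLipschitzInCharts I J f s ∧ MapsTo f s t ∧
    ∃ g : Y → X, LocallyLipschitzInCharts J I g t ∧ MapsTo g t s ∧ InvOn g f s t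

end ChartNotions

/-! ### Manifolds of class `C^{2,1}` and sprays -/

/-- The Euclidean space `ℝⁿ`. -/
abbrev EucR (n : ℕ) : Type := EuclideanSpace ℝ (Fin n)

/-- An `n`-dimensional `C^{2,1}` manifold: the coordinate changes of the atlas are `C²` and their
second derivatives are locally Lipschitz. -/
class IsC21Manifold (n : ℕ) (M : Type*) [TopologicalSpace M] [ChartedSpace (EucR n) M] : Prop
    extends IsManifold 𝓘(ℝ, EucR n) 2 M where
  locallyLipschitzOn_fderiv_fderiv : ∀ e ∈ atlas (EucR n) M, ∀ e' ∈ atlas (EucR n) M,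
    LocallyLipschitzOn (e.symm ≫ₕ e').source (fderiv ℝ (fderiv ℝ (e' ∘ e.symm)))

/-- A locally Lipschitz spray.  In each chart `e` it is given by a locally Lipschitz
function `H = coeff e` of position and velocity, positively homogeneous of degree two in the
velocity; these functions are related by the transformation law which makes the system
`x' = v`, `v' = H(x, v)` independent of the chart. -/
structure LipschitzSpray (n : ℕ) (M : Type*) [TopologicalSpace M] [ChartedSpace (EucR n) M] where
  /-- The right hand side `H(x, v)` in each chart; only its values at `x ∈ e.target` matter. -/
  coeff : atlas (EucR n) M → EucR n → EucR n → EucR n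
  locallyLipschitz : ∀ e : atlas (EucR n) M,
    LocallyLipschitzOn (e.1.target ×ˢ (univ : Set (EucR n)))
      (fun z : EucR n × EucR n => coeff e z.1 z.2)
  homogeneous : ∀ e : atlas (EucR n) M, ∀ x ∈ e.1.target, ∀ v : EucR n, ∀ s : ℝ, 0 < s →
    coeff e x (s • v) = s ^ 2 • coeff e x v
  transform : ∀ e e' : atlas (EucR n) M, ∀ x ∈ (e.1.symm ≫ₕ e'.1).source, ∀ v : EucR n,
    coeff e' (e'.1 (e.1.symm x)) (fderiv ℝ (e'.1 ∘ e.1.symm) x v) =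
      fderiv ℝ (fderiv ℝ (e'.1 ∘ e.1.symm)) x v v
        + fderiv ℝ (e'.1 ∘ e.1.symm) x (coeff e x v)

/-- The chart `(x, v)` of the tangent bundle induced by the chart `e` of the manifold. -/
noncomputable def tangentCoord (n : ℕ) {M : Type*} [TopologicalSpace M] [ChartedSpace (EucR n) M]
    (e : OpenPartialHomeomorph M (EucR n)) (v : TangentBundle 𝓘(ℝ, EucR n) M) :
    EucR n × EucR n :=
  (e v.proj, mfderiv 𝓘(ℝ, EucR n) 𝓘(ℝ, EucR n) e v.proj v.snd)

namespace LipschitzSpray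

variable {n : ℕ} {M : Type*} [TopologicalSpace M] [ChartedSpace (EucR n) M] [IsC21Manifold n M]

/-- `η` is, on the set `J` of times, a solution in the tangent bundle of the first order system
`x' = v`, `v' = H(x, v)` of the spray.  Then `t ↦ (η t).proj` is the geodesic (possibly
stationary) and `η` is its velocity. -/
def IsSolutionOn (S : LipschitzSpray n M) (η : ℝ → TangentBundle 𝓘(ℝ, EucR n) M)
    (J : Set ℝ) : Prop :=
  ContinuousOn η J ∧ ∀ t ∈ J, ∀ e : atlas (EucR n) M, (η t).proj ∈ e.1.source →
    HasDerivWithinAt (fun s => tangentCoord n e.1 (η s))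
      ((tangentCoord n e.1 (η t)).2,
        S.coeff e (tangentCoord n e.1 (η t)).1 (tangentCoord n e.1 (η t)).2) J t

/-- The domain `Ω` of the exponential map: the vectors `v` such that the solution with initial
velocity `v` exists at least on `[0, 1]`. -/
def expDomain (S : LipschitzSpray n M) : Set (TangentBundle 𝓘(ℝ, EucR n) M) :=
  {v | ∃ η : ℝ → TangentBundle 𝓘(ℝ, EucR n) M, η 0 = v ∧ S.IsSolutionOn η (Icc 0 1)}

open Classical in
/-- The end point `γ_v(1)` of the geodesic with initial velocity `v ∈ Ω` (the solution on `[0, 1]`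
is unique on a Hausdorff manifold, so that the choice is immaterial); the value outside `Ω` is
irrelevant. -/
noncomputable def endpoint (S : LipschitzSpray n M) (v : TangentBundle 𝓘(ℝ, EucR n) M) : M :=
  if h : v ∈ S.expDomain then (h.choose 1).proj else v.proj

/-- The exponential map `v ↦ (π(v), γ_v(1))`. -/
noncomputable def exp (S : LipschitzSpray n M) (v : TangentBundle 𝓘(ℝ, EucR n) M) : M × M :=
  (v.proj, S.endpoint v)

/-- The domain `Ω_p` of the pointed exponential map, as a set in the tangent space at `p`, which
is by definition the model space `ℝⁿ` (through the preferred chart at `p`). -/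
def expAtDomain (S : LipschitzSpray n M) (p : M) : Set (EucR n) :=
  {v | (⟨p, v⟩ : TangentBundle 𝓘(ℝ, EucR n) M) ∈ S.expDomain}

/-- The pointed exponential map `exp_p v = γ_v(1)`. -/
noncomputable def expAt (S : LipschitzSpray n M) (p : M) (v : EucR n) : M :=
  S.endpoint (⟨p, v⟩ : TangentBundle 𝓘(ℝ, EucR n) M)

end LipschitzSpray

/-! In a chart the spray is the locally Lipschitz first order field `(x, v) ↦ (v, H(x, v))`.
Picard–Lindelöf gives a local flow that is Lipschitz in the initial value, and the transformation
law of `H` makes its curves solutions in the tangent bundle. Chaining finitely many local flows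
along the compact time interval (`IsSolutionOn.exists_flow`), with uniqueness from
`IsSolutionOn.eqOn`, shows that `Ω` is open and that the end point depends on the initial velocity
in a Lipschitz way.

Strong differentiability at the zero section comes from homogeneity. Rescaling velocities by `s`
shows that `H` has Lipschitz constant of order `s` on velocities of size `s`, so its strict
derivative at `(x₀, 0)` is zero (`hasStrictFDerivAt_zero_of_homogeneous`). Two solutions near the
stationary one then have a velocity difference that is constant up to `ε|p - q|`. Integrating once
more, the time one position is `x + v` up to the same error (`exists_spray_flow_hasStrictFDerivAt`).
The differential of `exp` is therefore `(x, v) ↦ (x, x + v)`, which is invertible, and that of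
`exp_p` is the identity. The inverse function theorem needs a strict derivative at a single point
only, and yields local Lipeomorphisms (`exists_openPartialHomeomorph_of_hasStrictFDerivAt`).

To patch these together, note that `exp v` remembers the base point of `v`, so injectivity has to be
checked only within a fibre. With a locally finite cover of `M` shrunk to closed sets `C i`, and
local domains `G i` over them, the vectors lying in `G i` whenever their base point lies in `C i`
form an open star-shaped set on which `exp` is injective (`exists_isLipeomorphismOn_exp`). -/

theorem LipschitzOnWith.congr_eqOn {α β : Type*} [PseudoEMetricSpace α] [PseudoEMetricSpace β]
    {K : ℝ≥0} {f g : α → β} {s : Set α} (hf : LipschitzOnWith K f s) (h : EqOn g f s) :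
    LipschitzOnWith K g s := fun x hx y hy => by
  rw [h hx, h hy]
  exact hf hx hy

/-! ### Pointwise Lipschitz maps between manifolds and the inverse function theorem -/

section LipschitzAt

variable {F G F' : Type*} [NormedAddCommGroup F] [NormedSpace ℝ F]
  [NormedAddCommGroup G] [NormedSpace ℝ G] [NormedAddCommGroup F'] [NormedSpace ℝ F']
  {A B C : Type*} [TopologicalSpace A] [TopologicalSpace B] [TopologicalSpace C]
  {X Y Z : Type*} [TopologicalSpace X] [ChartedSpace A X] [TopologicalSpace Y] [ChartedSpace B Y]
  [TopologicalSpace Z] [ChartedSpace C Z]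

/-- `f` is continuous at `x` and its expression in the preferred charts is Lipschitz near `x`
(on a manifold without boundary). -/
def LipschitzAtInCharts (I : ModelWithCorners ℝ F A) (J : ModelWithCorners ℝ G B)
    (f : X → Y) (x : X) : Prop :=
  ContinuousAt f x ∧ ∃ K : ℝ≥0, ∃ t ∈ 𝓝 (extChartAt I x x),
    LipschitzOnWith K (writtenInExtChartAt I J x f) t

variable {I : ModelWithCorners ℝ F A} {J : ModelWithCorners ℝ G B} {K : ModelWithCorners ℝ F' C}

theorem tendsto_extChartAt_symm_nhds [I.Boundaryless] (x : X) :
    Tendsto (extChartAt I x).symm (𝓝 (extChartAt I x x)) (𝓝 x) := by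
  simpa using (continuousAt_extChartAt_symm (I := I) x).tendsto

/-- The preferred chart at `f x` is both the target chart of `f` and the source chart of `g`, so it
cancels near `x`; no smoothness of the coordinate changes is needed. -/
theorem LipschitzAtInCharts.comp [I.Boundaryless] {g : Y → Z} {f : X → Y} {x : X}
    (hg : LipschitzAtInCharts J K g (f x)) (hf : LipschitzAtInCharts I J f x) :
    LipschitzAtInCharts I K (g ∘ f) x := by
  obtain ⟨hgc, L, s, hs, hL⟩ := hg
  obtain ⟨hfc, L', t, ht, hL'⟩ := hf
  refine ⟨hgc.comp hfc, L * L', ?_⟩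
  have h1 : ∀ᶠ z in 𝓝 (extChartAt I x x), f ((extChartAt I x).symm z) ∈ (extChartAt J (f x)).source :=
    (hfc.tendsto.comp (tendsto_extChartAt_symm_nhds x)).eventually
      ((extChartAt_source_mem_nhds (I := J) (f x)))
  have h2 : ∀ᶠ z in 𝓝 (extChartAt I x x), writtenInExtChartAt I J x f z ∈ s := by
    refine (((continuousAt_extChartAt (I := J) (f x)).tendsto.comp hfc.tendsto).comp
      (tendsto_extChartAt_symm_nhds x)).eventually ?_
    simpa using hs
  refine ⟨_, inter_mem (inter_mem h1 h2) ht, ?_⟩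
  have := hL.comp (hL'.mono (inter_subset_right (s := {z | f ((extChartAt I x).symm z) ∈ (extChartAt J (f x)).source} ∩ {z | writtenInExtChartAt I J x f z ∈ s})))
    (fun z hz => hz.1.2)
  refine this.congr_eqOn fun z hz => ?_
  have h3 := (extChartAt J (f x)).left_inv hz.1.1
  simp only [writtenInExtChartAt, Function.comp_apply, h3]

theorem LipschitzAtInCharts.congr [I.Boundaryless] {f g : X → Y} {x : X}
    (hf : LipschitzAtInCharts I J f x) (h : g =ᶠ[𝓝 x] f) : LipschitzAtInCharts I J g x := by
  obtain ⟨hfc, L', t, ht, hL'⟩ := hf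
  refine ⟨hfc.congr h.symm, L', _,
    inter_mem ht ((tendsto_extChartAt_symm_nhds x).eventually h), ?_⟩
  refine (hL'.mono inter_subset_left).congr_eqOn fun z hz => ?_
  have h1 : g ((extChartAt I x).symm z) = f ((extChartAt I x).symm z) := hz.2
  simp only [writtenInExtChartAt, Function.comp_apply, h1, h.eq_of_nhds]

theorem ContMDiffAt.lipschitzAtInCharts [I.Boundaryless] {f : X → Y} {x : X}
    (hf : ContMDiffAt I J 1 f x) : LipschitzAtInCharts I J f x := by
  obtain ⟨hc, hd⟩ := contMDiffAt_iff.1 hf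
  rw [I.range_eq_univ, contDiffWithinAt_univ] at hd
  exact ⟨hc, hd.exists_lipschitzOnWith⟩

theorem LipschitzOnWith.lipschitzAtInCharts {f : F → G} {x : F} {L : ℝ≥0} {t : Set F}
    (hf : LipschitzOnWith L f t) (ht : t ∈ 𝓝 x) : LipschitzAtInCharts 𝓘(ℝ, F) 𝓘(ℝ, G) f x := by
  refine ⟨hf.continuousOn.continuousAt ht, L, t, ?_, ?_⟩
  · rwa [ext_chart_model_space_apply]
  · rwa [writtenInExtChartAt_model_space]

theorem LipschitzAtInCharts.prodMk [I.Boundaryless] {f : X → Y} {g : X → Z} {x : X}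
    (hf : LipschitzAtInCharts I J f x) (hg : LipschitzAtInCharts I K g x) :
    LipschitzAtInCharts I (J.prod K) (fun y => (f y, g y)) x := by
  obtain ⟨hfc, L, s, hs, hL⟩ := hf
  obtain ⟨hgc, L', t, ht, hL'⟩ := hg
  refine ⟨hfc.prodMk hgc, max L L', _, inter_mem hs ht, ?_⟩
  have := (hL.mono inter_subset_left).prodMk (hL'.mono (inter_subset_right (s := s)))
  refine this.congr_eqOn fun z hz => ?_
  simp [writtenInExtChartAt]

theorem locallyLipschitzInCharts_of_forall {f : X → Y} {s : Set X}
    (h : ∀ x ∈ s, LipschitzAtInCharts I J f x) : LocallyLipschitzInCharts I J f s := by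
  refine ⟨fun x hx => (h x hx).1.continuousWithinAt, fun x hx => ?_⟩
  obtain ⟨-, L, t, ht, hL⟩ := h x hx
  exact ⟨L, t, mem_nhdsWithin_of_mem_nhds ht, hL⟩

/-- An injective map which is near every point a local Lipeomorphism is a Lipeomorphism onto its
image, which is open. -/
theorem isLipeomorphismOn_image_of_injOn [J.Boundaryless] [Nonempty X] {f : X → Y} {N : Set X}
    (hN : IsOpen N) (hinj : InjOn f N) (hlip : ∀ x ∈ N, LipschitzAtInCharts I J f x)
    (hloc : ∀ x ∈ N, ∃ φ : OpenPartialHomeomorph X Y, x ∈ φ.source ∧ EqOn φ f φ.source ∧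
      ∀ y ∈ φ.target, LipschitzAtInCharts J I φ.symm y) :
    IsOpen (f '' N) ∧ IsLipeomorphismOn I J f N (f '' N) := by
  -- Near `f x` the local inverse `φ.symm` takes values in `N`, so injectivity on `N` forces it to
  -- agree with the global inverse, which inherits its Lipschitz property.
  have key : ∀ x ∈ N, f '' N ∈ 𝓝 (f x) ∧ LipschitzAtInCharts J I (Function.invFunOn f N) (f x) := by
    intro x hx
    obtain ⟨φ, hxφ, hφ, hφl⟩ := hloc x hx
    have hfx : f x ∈ φ.target := by rw [← hφ hxφ]; exact φ.map_source hxφ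
    have hsx : φ.symm (f x) = x := by rw [← hφ hxφ, φ.left_inv hxφ]
    have h1 : ∀ᶠ y in 𝓝 (f x), φ.symm y ∈ N := by
      refine (φ.continuousAt_symm hfx).eventually ?_
      rw [hsx]
      exact hN.mem_nhds hx
    have h2 : ∀ᶠ y in 𝓝 (f x), φ.symm y ∈ N ∧ f (φ.symm y) = y := by
      filter_upwards [h1, φ.open_target.mem_nhds hfx] with y hy hyt
      exact ⟨hy, by rw [← hφ (φ.map_target hyt), φ.right_inv hyt]⟩
    refine ⟨?_, (hφl _ hfx).congr ?_⟩
    · filter_upwards [h2] with y hy using ⟨_, hy.1, hy.2⟩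
    · filter_upwards [h2] with y hy
      have hy' : y ∈ f '' N := ⟨_, hy.1, hy.2⟩
      exact hinj (Function.invFunOn_mem hy') hy.1 (by rw [Function.invFunOn_eq hy', hy.2])
  refine ⟨isOpen_iff_mem_nhds.2 ?_, locallyLipschitzInCharts_of_forall hlip, mapsTo_image f N,
    Function.invFunOn f N, locallyLipschitzInCharts_of_forall ?_, ?_, ?_, ?_⟩
  · rintro _ ⟨x, hx, rfl⟩
    exact (key x hx).1
  · rintro _ ⟨x, hx, rfl⟩
    exact (key x hx).2
  · exact fun y hy => Function.invFunOn_mem hy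
  · exact hinj.leftInvOn_invFunOn
  · exact fun y hy => Function.invFunOn_eq hy

variable [I.Boundaryless]

/-- The extended chart at `x` of a manifold without boundary. -/
noncomputable def boundarylessChartAt (I : ModelWithCorners ℝ F A) [I.Boundaryless] (x : X) :
    OpenPartialHomeomorph X F :=
  (chartAt A x).trans I.toHomeomorph.toOpenPartialHomeomorph

theorem boundarylessChartAt_coe (x : X) :
    (boundarylessChartAt I x : X → F) = extChartAt I x := rfl

theorem boundarylessChartAt_source (x : X) :
    (boundarylessChartAt I x).source = (extChartAt I x).source := by
  simp [boundarylessChartAt]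

theorem boundarylessChartAt_target (x : X) :
    (boundarylessChartAt I x).target = (extChartAt I x).target := by
  rw [← (boundarylessChartAt I x).image_source_eq_target, boundarylessChartAt_coe,
    boundarylessChartAt_source, (extChartAt I x).image_source_eq_target]

/-- Read in the preferred chart at `y`, the chart at `x` is a coordinate change, and `C¹` maps are
Lipschitz near each point. -/
theorem lipschitzAtInCharts_extChartAt [IsManifold I 1 X] {x y : X}
    (hy : y ∈ (extChartAt I x).source) :
    LipschitzAtInCharts I 𝓘(ℝ, F) (extChartAt I x) y :=
  (contMDiffAt_extChartAt' (by simpa using hy)).lipschitzAtInCharts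

theorem lipschitzAtInCharts_extChartAt_symm [IsManifold I 1 X] {x : X} {z : F}
    (hz : z ∈ (extChartAt I x).target) :
    LipschitzAtInCharts 𝓘(ℝ, F) I (extChartAt I x).symm z := by
  refine ContMDiffAt.lipschitzAtInCharts ?_
  exact (contMDiffOn_extChartAt_symm x).contMDiffAt
    ((isOpen_extChartAt_target (I := I) x).mem_nhds hz)

/-- The inverse function theorem for maps which are strictly differentiable at one point only:
the local inverse is Lipschitz near every point. -/
theorem exists_openPartialHomeomorph_of_hasStrictFDerivAt [J.Boundaryless] [CompleteSpace F]
    [IsManifold I 1 X] [IsManifold J 1 Y] {f : X → Y} {x : X} (L : F ≃L[ℝ] G)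
    (hc : ContinuousAt f x)
    (hf : HasStrictFDerivAt (writtenInExtChartAt I J x f) (L : F →L[ℝ] G) (extChartAt I x x)) :
    ∃ φ : OpenPartialHomeomorph X Y, x ∈ φ.source ∧ EqOn φ f φ.source ∧
      ∀ y ∈ φ.target, LipschitzAtInCharts J I φ.symm y := by
  obtain ⟨s, hxs, hs, hfs⟩ := hf.approximates_deriv_on_open_nhds
  -- Half of the threshold below which a perturbation of `L` stays invertible; halving is strict
  -- unless the norm is zero, and then `F` is trivial.
  set c : ℝ≥0 := ‖(L.symm : G →L[ℝ] F)‖₊⁻¹ / 2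
  have hcL : Subsingleton F ∨ c < ‖(L.symm : G →L[ℝ] F)‖₊⁻¹ :=
    L.subsingleton_or_nnnorm_symm_pos.imp id fun h => NNReal.half_lt_self (inv_pos.2 h).ne'
  let ψ := hfs.toOpenPartialHomeomorph _ s hcL hs
  have hψ : ∀ z ∈ ψ.target, LipschitzAtInCharts 𝓘(ℝ, G) 𝓘(ℝ, F) ψ.symm z := fun z hz => by
    have h1 := lipschitzOnWith_iff_restrict.2 (hfs.to_inv hcL).lipschitz
    exact h1.lipschitzAtInCharts (ψ.open_target.mem_nhds hz)
  let e := boundarylessChartAt I x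
  let e' := boundarylessChartAt J (f x)
  have hU : {y | y ∈ e.source ∧ f y ∈ e'.source} ∈ 𝓝 x := by
    refine inter_mem (e.open_source.mem_nhds ?_) (hc (e'.open_source.mem_nhds ?_)) <;>
    simp [e, e', boundarylessChartAt_source]
  obtain ⟨U, hUs, hUo, hxU⟩ := mem_nhds_iff.1 hU
  have hex : e x ∈ ψ.source := hxs
  have hψe : ∀ y ∈ U, ψ (e y) = e' (f y) := fun y hy => by
    have : e.symm (e y) = y := e.left_inv (hUs hy).1
    change extChartAt J (f x) (f (e.symm (e y))) = _
    rw [this]; rfl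
  -- On `U` the map `f` stays inside the chart at `f x`, so the local homeomorphism `ψ` between
  -- model spaces lifts back to `f` itself.
  let φ := (((e.trans ψ).trans e'.symm).restrOpen U hUo)
  refine ⟨φ, ⟨⟨⟨?_, hex⟩, ?_⟩, hxU⟩, fun y hy => ?_, fun y hy => ?_⟩
  · exact (hUs hxU).1
  · change ψ (e x) ∈ e'.target
    rw [hψe x hxU]
    exact e'.map_source (hUs hxU).2
  · change e'.symm (ψ (e y)) = f y
    rw [hψe y hy.2, e'.left_inv (hUs hy.2).2]
  · have hy1 : y ∈ e'.source := by
      have := φ.map_target hy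
      rw [← φ.right_inv hy]
      change e'.symm (ψ (e (φ.symm y))) ∈ _
      rw [hψe _ this.2, e'.left_inv (hUs this.2).2]
      exact (hUs this.2).2
    have hy2 : e' y ∈ ψ.target := by
      have := φ.map_target hy
      rw [← φ.right_inv hy]
      change e' (e'.symm (ψ (e (φ.symm y)))) ∈ _
      have h4 : ψ (e (φ.symm y)) ∈ e'.target := this.1.2
      rw [e'.right_inv h4]
      exact ψ.map_source this.1.1.2
    have hy3 : ψ.symm (e' y) ∈ e.target := by
      have := φ.map_target hy
      rw [← φ.right_inv hy]
      change ψ.symm (e' (e'.symm (ψ (e (φ.symm y))))) ∈ _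
      have h4 : ψ (e (φ.symm y)) ∈ e'.target := this.1.2
      have h5 : e (φ.symm y) ∈ ψ.source := this.1.1.2
      rw [e'.right_inv h4, ψ.left_inv h5]
      exact e.map_source this.1.1.1
    have h1 : LipschitzAtInCharts J 𝓘(ℝ, G) e' y :=
      lipschitzAtInCharts_extChartAt (by rwa [← boundarylessChartAt_source])
    have h3 : LipschitzAtInCharts 𝓘(ℝ, F) I e.symm (ψ.symm (e' y)) :=
      lipschitzAtInCharts_extChartAt_symm (by rwa [← boundarylessChartAt_target])
    exact (h3.comp (hψ _ hy2)).comp h1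

end LipschitzAt

/-! ### Flows of Lipschitz fields, and of sprays near a stationary point, in a vector space -/

section Flow

open Metric

/-- The local flow of a Lipschitz autonomous vector field, inside a prescribed neighbourhood. -/
theorem LipschitzOnWith.exists_local_flow {E : Type*} [NormedAddCommGroup E] [NormedSpace ℝ E]
    [CompleteSpace E] {F : E → E} {z₀ : E} {K : ℝ≥0} {t O : Set E} (hF : LipschitzOnWith K F t)
    (ht : t ∈ 𝓝 z₀) (hO : O ∈ 𝓝 z₀) :
    ∃ δ > 0, ∃ r > 0, ∃ (L : ℝ≥0) (α : E → ℝ → E),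
      (∀ z ∈ closedBall z₀ r, α z 0 = z ∧ ∀ s ∈ Icc 0 δ, α z s ∈ O ∧
        HasDerivWithinAt (α z) (F (α z s)) (Icc 0 δ) s) ∧
      ∀ s ∈ Icc 0 δ, LipschitzOnWith L (fun z => α z s) (closedBall z₀ r) := by
  obtain ⟨a, ha, hat⟩ := nhds_basis_closedBall.mem_iff.1 (inter_mem ht hO)
  lift a to ℝ≥0 using ha.le
  have hat1 : closedBall z₀ a ⊆ t := fun x hx => (hat hx).1
  -- A bound for `F` on the ball of radius `a`; the summand `1` keeps it positive, so that one may
  -- divide by it.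
  let C : ℝ≥0 := K * a + ‖F z₀‖₊ + 1
  have hC0 : (0 : ℝ) < C := by positivity
  have hb : ∀ x ∈ closedBall z₀ a, ‖F x‖ ≤ C := fun x hx => by
    have h1 := hF.norm_sub_le (hat1 hx) (hat1 (mem_closedBall_self ha.le))
    have h2 : ‖x - z₀‖ ≤ a := mem_closedBall_iff_norm.1 hx
    have h3 := norm_le_norm_sub_add (F x) (F z₀)
    have h4 : (K : ℝ) * ‖x - z₀‖ ≤ K * a := by gcongr
    have h5 : (C : ℝ) = K * a + ‖F z₀‖ + 1 := by simp [C]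
    linarith
  -- At speed at most `C`, a curve starting within `a / 2` of the centre cannot leave the ball of
  -- radius `a` before this time.
  let δ₀ : ℝ := a / 2 / C
  have hδ₀ : 0 < δ₀ := by positivity
  have hPL : IsPicardLindelof (fun _ => F) (tmin := 0) (tmax := δ₀) ⟨0, le_rfl, hδ₀.le⟩
      z₀ a (a / 2) C K := by
    refine .of_time_independent hb (hF.mono hat1) ?_
    have : max (δ₀ - 0) ((0 : ℝ) - 0) = δ₀ := by simp [hδ₀.le]
    simp only [this]
    have h1 : (C : ℝ) * δ₀ = a / 2 := by simp only [δ₀]; field_simp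
    rw [h1]
    push_cast
    linarith
  obtain ⟨α, hα, L, hL⟩ :=
    hPL.exists_forall_mem_closedBall_eq_hasDerivWithinAt_lipschitzOnWith
  have hr₀ : ((a / 2 : ℝ≥0) : ℝ) = a / 2 := by simp
  rw [hr₀] at hα hL
  have hz₀ := hα z₀ (mem_closedBall_self (by positivity))
  have hcont : ContinuousWithinAt (α z₀) (Icc 0 δ₀) 0 :=
    (hz₀.2 0 ⟨le_rfl, hδ₀.le⟩).continuousWithinAt
  have hev : ∀ᶠ s in 𝓝[Icc 0 δ₀] 0, α z₀ s ∈ closedBall z₀ (a / 2) := by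
    refine hcont.eventually ?_
    have h0 : α z₀ 0 = z₀ := hz₀.1
    rw [h0]
    exact closedBall_mem_nhds _ (by positivity)
  obtain ⟨η, hη, hηs⟩ := Metric.mem_nhdsWithin_iff.1 hev
  -- Until time `η / 2` the central solution stays within `a / 2` of `z₀`; starting points within `a
  -- / 2 / (L + 1)` add at most another `a / 2`. So all solutions remain in the ball of radius `a`,
  -- inside `O`.
  refine ⟨min δ₀ (η / 2), by positivity, min (a / 2) (a / 2 / (L + 1)), by positivity, L, α,
    fun z hz => ?_, fun s hs => (hL s ⟨hs.1, hs.2.trans (min_le_left _ _)⟩).mono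
      (closedBall_subset_closedBall (min_le_left _ _))⟩
  have hz' := hα z (closedBall_subset_closedBall (min_le_left _ _) hz)
  refine ⟨hz'.1, fun s hs => ?_⟩
  have hs' : s ∈ Icc 0 δ₀ := ⟨hs.1, hs.2.trans (min_le_left _ _)⟩
  refine ⟨(hat ?_).2, (hz'.2 s hs').mono (Icc_subset_Icc_right (min_le_left _ _))⟩
  have h1 : dist (α z₀ s) z₀ ≤ a / 2 := by
    refine hηs ⟨?_, hs'⟩
    have : s ≤ η / 2 := hs.2.trans (min_le_right _ _)
    rw [mem_ball, Real.dist_eq, sub_zero, abs_of_nonneg hs.1]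
    linarith
  have h2 : dist (α z s) (α z₀ s) ≤ L * dist z z₀ :=
    (hL s hs').dist_le_mul z (closedBall_subset_closedBall (min_le_left _ _) hz) z₀
      (mem_closedBall_self (by positivity))
  have h3 : L * dist z z₀ ≤ a / 2 := by
    have h4 : dist z z₀ ≤ a / 2 / (L + 1) := (mem_closedBall.1 hz).trans (min_le_right _ _)
    calc (L : ℝ) * dist z z₀ ≤ (L + 1) * (a / 2 / (L + 1)) := by gcongr; linarith
      _ = a / 2 := by field_simp
  rw [mem_closedBall]
  linarith [dist_triangle (α z s) (α z₀ s) z₀]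

variable {V : Type*} [NormedAddCommGroup V] [NormedSpace ℝ V]

/-- A function homogeneous of degree two in the velocity and Lipschitz near `(x₀, 0)` has vanishing
strict derivative there. -/
theorem hasStrictFDerivAt_zero_of_homogeneous {H : V × V → V} {x₀ : V} {U : Set V} {K : ℝ≥0}
    {t : Set (V × V)} (hU : U ∈ 𝓝 x₀)
    (hom : ∀ x ∈ U, ∀ v : V, ∀ s : ℝ, 0 < s → H (x, s • v) = s ^ 2 • H (x, v))
    (ht : t ∈ 𝓝 (x₀, (0 : V))) (hH : LipschitzOnWith K H t) :
    HasStrictFDerivAt H (0 : V × V →L[ℝ] V) (x₀, 0) := by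
  obtain ⟨a, ha, hat⟩ := nhds_basis_closedBall.mem_iff.1
    (inter_mem ht (prod_mem_nhds hU (univ_mem (f := 𝓝 (0 : V)))))
  refine .of_isLittleO (Asymptotics.isLittleO_iff.2 fun ε hε => ?_)
  -- Writing `H(x, v) = s² H(x, v/s)`, the factor `s²` beats the `1/s` lost by rescaling, so `H` is
  -- `K s`-Lipschitz where `|v| ≤ s a`.
  obtain ⟨s, hs0, hs1, hsε⟩ : ∃ s : ℝ, 0 < s ∧ s ≤ 1 ∧ K * s ≤ ε := by
    refine ⟨min 1 (ε / (K + 1)), by positivity, min_le_left _ _, ?_⟩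
    calc (K : ℝ) * min 1 (ε / (K + 1)) ≤ (K + 1) * (ε / (K + 1)) := by
          gcongr
          · linarith
          · exact min_le_right _ _
      _ = ε := by field_simp
  have hB : closedBall x₀ a ×ˢ closedBall (0 : V) (s * a) ∈ 𝓝 (x₀, (0 : V)) :=
    prod_mem_nhds (closedBall_mem_nhds _ ha) (closedBall_mem_nhds _ (by positivity))
  have hresc : ∀ p ∈ closedBall x₀ a ×ˢ closedBall (0 : V) (s * a),
      (p.1, s⁻¹ • p.2) ∈ t ∧ H p = s ^ 2 • H (p.1, s⁻¹ • p.2) := by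
    rintro ⟨x, v⟩ ⟨hx, hv⟩
    have hmem : (x, s⁻¹ • v) ∈ closedBall (x₀, (0 : V)) a := by
      rw [← closedBall_prod_same]
      refine ⟨hx, ?_⟩
      rw [mem_closedBall_zero_iff] at hv ⊢
      rw [norm_smul, norm_inv, Real.norm_of_nonneg hs0.le, inv_mul_le_iff₀ hs0]
      exact hv
    refine ⟨(hat hmem).1, ?_⟩
    rw [← hom x (hat hmem).2.1 _ s hs0, smul_inv_smul₀ hs0.ne']
  filter_upwards [prod_mem_nhds hB hB] with ⟨p, q⟩ ⟨hp, hq⟩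
  obtain ⟨hpt, hp⟩ := hresc p hp
  obtain ⟨hqt, hq⟩ := hresc q hq
  simp only [zero_apply, sub_zero]
  have h1 := hH.norm_sub_le hpt hqt
  have h2 : s * ‖(p.1, s⁻¹ • p.2) - (q.1, s⁻¹ • q.2)‖ ≤ ‖p - q‖ := by
    rw [Prod.mk_sub_mk, Prod.norm_def, ← smul_sub, norm_smul, norm_inv,
      Real.norm_of_nonneg hs0.le, mul_max_of_nonneg _ _ hs0.le, mul_inv_cancel_left₀ hs0.ne']
    refine max_le ?_ (norm_snd_le (p - q))
    calc s * ‖p.1 - q.1‖ ≤ 1 * ‖p.1 - q.1‖ := by gcongr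
      _ = ‖(p - q).1‖ := by simp
      _ ≤ _ := norm_fst_le (p - q)
  calc ‖H p - H q‖ = s ^ 2 * ‖H (p.1, s⁻¹ • p.2) - H (q.1, s⁻¹ • q.2)‖ := by
        rw [hp, hq, ← smul_sub, norm_smul, Real.norm_of_nonneg (by positivity)]
    _ ≤ s ^ 2 * (K * ‖(p.1, s⁻¹ • p.2) - (q.1, s⁻¹ • q.2)‖) := by gcongr
    _ = K * s * (s * ‖(p.1, s⁻¹ • p.2) - (q.1, s⁻¹ • q.2)‖) := by ring
    _ ≤ ε * ‖p - q‖ := by gcongr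

/-- Near a stationary point `(x₀, 0)` the flow of a spray exists up to time one. -/
theorem exists_spray_flow [CompleteSpace V] {H : V × V → V} {x₀ : V} {U : Set V} {K : ℝ≥0}
    {t O : Set (V × V)} (hU : U ∈ 𝓝 x₀)
    (hom : ∀ x ∈ U, ∀ v : V, ∀ s : ℝ, 0 < s → H (x, s • v) = s ^ 2 • H (x, v))
    (ht : t ∈ 𝓝 (x₀, (0 : V))) (hH : LipschitzOnWith K H t) (hO : O ∈ 𝓝 (x₀, (0 : V))) :
    ∃ r > 0, ∃ (L : ℝ≥0) (β : V × V → ℝ → V × V),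
      (∀ z ∈ closedBall (x₀, (0 : V)) r, β z 0 = z ∧ ∀ s ∈ Icc (0 : ℝ) 1, β z s ∈ O ∧
        HasDerivWithinAt (β z) ((β z s).2, H (β z s)) (Icc 0 1) s) ∧
      ∀ s ∈ Icc (0 : ℝ) 1, LipschitzOnWith L (fun z => β z s) (closedBall (x₀, (0 : V)) r) := by
  obtain ⟨a, ha, haO⟩ := nhds_basis_closedBall.mem_iff.1
    (inter_mem hO (prod_mem_nhds hU (univ_mem (f := 𝓝 (0 : V)))))
  have hF : LipschitzOnWith (max 1 K) (fun z : V × V => (z.2, H z)) t :=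
    (LipschitzWith.prod_snd.lipschitzOnWith).prodMk hH
  obtain ⟨δ₀, hδ₀, r, hr, L, α, hα, hL⟩ :=
    hF.exists_local_flow ht (closedBall_mem_nhds (x₀, (0 : V)) ha)
  obtain ⟨δ, hδ, hδ1, hδδ⟩ : ∃ δ : ℝ, 0 < δ ∧ δ ≤ 1 ∧ δ ≤ δ₀ :=
    ⟨min 1 δ₀, by positivity, min_le_left _ _, min_le_right _ _⟩
  -- Scaling of velocities. If `(x, v)` solves the system on `[0, δ]`, then `s ↦ (x(δ s), δ v(δ s))`
  -- solves it on `[0, 1]`, by homogeneity of degree two; its initial velocity must be divided by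
  -- `δ` beforehand, hence the radius `δ * r`.
  let S : ℝ → (V × V) →L[ℝ] V × V := fun c =>
    (ContinuousLinearMap.fst ℝ V V).prod (c • ContinuousLinearMap.snd ℝ V V)
  have hS : ∀ c z, S c z = (z.1, c • z.2) := fun c z => rfl
  have hSb : MapsTo (S δ⁻¹) (closedBall (x₀, (0 : V)) (δ * r)) (closedBall (x₀, (0 : V)) r) := by
    intro z hz
    rw [← closedBall_prod_same] at hz ⊢
    refine ⟨closedBall_subset_closedBall ?_ hz.1, ?_⟩
    · nlinarith
    · have := hz.2
      rw [mem_closedBall_zero_iff] at this ⊢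
      rw [hS, norm_smul, norm_inv, Real.norm_of_nonneg hδ.le, inv_mul_le_iff₀ hδ]
      exact this
  have htime : MapsTo (fun s : ℝ => δ * s) (Icc 0 1) (Icc 0 δ₀) := fun s hs =>
    ⟨mul_nonneg hδ.le hs.1, le_trans (by nlinarith [hs.2]) hδδ⟩
  refine ⟨δ * r, by positivity, ‖S δ‖₊ * L * ‖S δ⁻¹‖₊, fun z s => S δ (α (S δ⁻¹ z) (δ * s)),
    fun z hz => ?_, fun s hs => ?_⟩
  · obtain ⟨h0, hd⟩ := hα _ (hSb hz)
    refine ⟨?_, fun s hs => ?_⟩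
    · simp only [mul_zero, h0]
      rw [hS, hS, smul_inv_smul₀ hδ.ne']
    obtain ⟨hm, hds⟩ := hd _ (htime hs)
    have hm' := hm
    rw [← closedBall_prod_same] at hm'
    refine ⟨(haO ?_).1, ?_⟩
    · rw [← closedBall_prod_same]
      refine ⟨hm'.1, ?_⟩
      have := hm'.2
      rw [mem_closedBall_zero_iff] at this ⊢
      change ‖δ • (α (S δ⁻¹ z) (δ * s)).2‖ ≤ a
      change ‖(α (S δ⁻¹ z) (δ * s)).2‖ ≤ a at this
      rw [norm_smul, Real.norm_of_nonneg hδ.le]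
      nlinarith [norm_nonneg (α (S δ⁻¹ z) (δ * s)).2]
    · have h1 : HasDerivWithinAt (fun s : ℝ => δ * s) δ (Icc 0 1) s := by
        simpa using ((hasDerivAt_id s).const_mul δ).hasDerivWithinAt
      have h2 := (S δ).hasFDerivAt.comp_hasDerivWithinAt s (hds.scomp s h1 htime)
      refine h2.congr_deriv ?_
      have h3 : H (S δ (α (S δ⁻¹ z) (δ * s))) = δ ^ 2 • H (α (S δ⁻¹ z) (δ * s)) :=
        hom _ (haO hm).2.1 _ δ hδ
      refine Prod.ext rfl ?_
      change δ • δ • H (α (S δ⁻¹ z) (δ * s)) = H (S δ (α (S δ⁻¹ z) (δ * s)))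
      rw [h3, smul_smul, sq]
  · exact ((S δ).lipschitz.comp_lipschitzOnWith (hL _ (htime hs))).comp
      ((S δ⁻¹).lipschitz.lipschitzOnWith) hSb

/-- The time one map of the flow of a spray, followed by the projection, is strictly differentiable
at a stationary point `(x₀, 0)`, with differential `(x, v) ↦ x + v`. -/
theorem exists_spray_flow_hasStrictFDerivAt [CompleteSpace V] {H : V × V → V} {x₀ : V}
    {U : Set V} {K : ℝ≥0} {t O : Set (V × V)} (hU : U ∈ 𝓝 x₀)
    (hom : ∀ x ∈ U, ∀ v : V, ∀ s : ℝ, 0 < s → H (x, s • v) = s ^ 2 • H (x, v))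
    (ht : t ∈ 𝓝 (x₀, (0 : V))) (hH : LipschitzOnWith K H t) (hO : O ∈ 𝓝 (x₀, (0 : V))) :
    ∃ β : V × V → ℝ → V × V,
      (∀ᶠ z in 𝓝 (x₀, (0 : V)), β z 0 = z ∧ ∀ s ∈ Icc (0 : ℝ) 1, β z s ∈ O ∧
        HasDerivWithinAt (β z) ((β z s).2, H (β z s)) (Icc 0 1) s) ∧
      HasStrictFDerivAt (fun z => (β z 1).1)
        (ContinuousLinearMap.fst ℝ V V + ContinuousLinearMap.snd ℝ V V) (x₀, 0) := by
  obtain ⟨r, hr, L, β, hβ, hL⟩ := exists_spray_flow hU hom ht hH (inter_mem hO ht)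
  refine ⟨β, ?_, ?_⟩
  · filter_upwards [closedBall_mem_nhds _ hr] with z hz
    exact ⟨(hβ z hz).1, fun s hs => ⟨((hβ z hz).2 s hs).1.1, ((hβ z hz).2 s hs).2⟩⟩
  have hz₀ : (x₀, (0 : V)) ∈ closedBall (x₀, (0 : V)) r := mem_closedBall_self hr.le
  have hH0 : H (x₀, 0) = 0 := by
    have h := hom x₀ (mem_of_mem_nhds hU) 0 2 (by norm_num)
    rw [smul_zero] at h
    have h' : (3 : ℝ) • H (x₀, 0) = 0 := by
      have : (3 : ℝ) • H (x₀, 0) = (2 : ℝ) ^ 2 • H (x₀, 0) - H (x₀, 0) := by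
        module
      rw [this, ← h, sub_self]
    simpa using h'
  have hIci : ∀ {f : ℝ → V × V} {f' : V × V} {s : ℝ}, s ∈ Ico (0 : ℝ) 1 →
      HasDerivWithinAt f f' (Icc 0 1) s → HasDerivWithinAt f f' (Ici s) s := fun hs h =>
    h.mono_of_mem_nhdsWithin (Icc_mem_nhdsGE_of_mem hs)
  have hF : LipschitzOnWith (max 1 K) (fun z : V × V => (z.2, H z)) t :=
    (LipschitzWith.prod_snd.lipschitzOnWith).prodMk hH
  -- The constant curve is a solution since `H(x₀, 0) = 0`. This anchors the Lipschitz estimate: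
  -- solutions starting near `(x₀, 0)` stay near it up to time one.
  have hstat : EqOn (β (x₀, 0)) (fun _ => (x₀, 0)) (Icc 0 1) := by
    refine ODE_solution_unique_of_mem_Icc_right (v := fun _ z => (z.2, H z)) (s := fun _ => t)
      (fun _ _ => hF)
      (HasDerivWithinAt.continuousOn fun s hs => ((hβ _ hz₀).2 s hs).2)
      (fun s hs => hIci hs ((hβ _ hz₀).2 s (Ico_subset_Icc_self hs)).2)
      (fun s hs => ((hβ _ hz₀).2 s (Ico_subset_Icc_self hs)).1.2)
      continuousOn_const (fun s hs => ?_) (fun s hs => mem_of_mem_nhds ht) (hβ _ hz₀).1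
    simp only [hH0]
    exact hasDerivWithinAt_const _ _ _
  have hstrict := hasStrictFDerivAt_zero_of_homogeneous hU hom ht hH
  refine .of_isLittleO (Asymptotics.isLittleO_iff.2 fun ε hε => ?_)
  -- The smallness required of `H` is divided by `L + 1` to absorb the Lipschitz constant `L` of the
  -- flow.
  have hc : 0 < ε / (L + 1) := by positivity
  have hev := Asymptotics.isLittleO_iff.1 hstrict.isLittleO hc
  obtain ⟨ρ, hρ, hρs⟩ := Metric.mem_nhds_iff.1 hev
  have hsmall : ∀ᶠ z in 𝓝 (x₀, (0 : V)), ∀ s ∈ Icc (0 : ℝ) 1, β z s ∈ ball (x₀, (0 : V)) ρ := by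
    filter_upwards [closedBall_mem_nhds _ hr,
      ball_mem_nhds (x₀, (0 : V)) (show 0 < ρ / (L + 1) by positivity)] with z hz hzρ s hs
    have h1 : dist (β z s) (β (x₀, 0) s) ≤ L * dist z (x₀, 0) := (hL s hs).dist_le_mul z hz _ hz₀
    rw [hstat hs] at h1
    rw [mem_ball] at hzρ ⊢
    refine lt_of_le_of_lt h1 ?_
    calc (L : ℝ) * dist z (x₀, 0) ≤ (L + 1) * dist z (x₀, 0) := by gcongr; linarith
      _ < (L + 1) * (ρ / (L + 1)) := by gcongr
      _ = ρ := by field_simp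
  have hgood := hsmall.and (closedBall_mem_nhds (x₀, (0 : V)) hr)
  filter_upwards [prod_mem_nhds hgood hgood] with ⟨p, q⟩ ⟨⟨hp, hpr⟩, ⟨hq, hqr⟩⟩
  have hCle : ε / (L + 1) * (L * ‖p - q‖) ≤ ε * ‖p - q‖ := by
    rw [← mul_assoc]
    gcongr
    rw [div_mul_eq_mul_div, div_le_iff₀ (by positivity)]
    gcongr
    linarith
  have hd : ∀ s ∈ Icc (0 : ℝ) 1, HasDerivWithinAt (fun s => β p s - β q s)
      ((β p s).2 - (β q s).2, H (β p s) - H (β q s)) (Icc 0 1) s := fun s hs => by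
    exact ((hβ p hpr).2 s hs).2.sub ((hβ q hqr).2 s hs).2
  have hHd : ∀ s ∈ Icc (0 : ℝ) 1, ‖H (β p s) - H (β q s)‖ ≤ ε * ‖p - q‖ := fun s hs => by
    have h1 : ‖H (β p s) - H (β q s)‖ ≤ ε / (L + 1) * ‖β p s - β q s‖ := by
      have : (β p s, β q s) ∈ ball ((x₀, (0 : V)), (x₀, (0 : V))) ρ := by
        rw [← ball_prod_same]
        exact ⟨hp s hs, hq s hs⟩
      simpa using hρs this
    refine h1.trans (le_trans ?_ hCle)
    gcongr
    exact (hL s hs).norm_sub_le hpr hqr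
  have hsnd : ∀ s ∈ Icc (0 : ℝ) 1, ‖(β p s).2 - (β q s).2 - (p - q).2‖ ≤ ε * ‖p - q‖ := by
    intro s hs
    have := norm_image_sub_le_of_norm_deriv_le_segment' (f := fun s => (β p s).2 - (β q s).2)
      (f' := fun s => H (β p s) - H (β q s)) (a := 0) (b := 1) (C := ε * ‖p - q‖)
      (fun s hs => ((ContinuousLinearMap.snd ℝ V V).hasFDerivAt.comp_hasDerivWithinAt s (hd s hs)))
      (fun s hs => hHd s (Ico_subset_Icc_self hs)) s hs
    simp only [(hβ p hpr).1, (hβ q hqr).1, sub_zero] at this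
    refine this.trans ?_
    have hn : 0 ≤ ε * ‖p - q‖ := by positivity
    nlinarith [hs.2]
  -- Second integration: after subtracting the uniform motion `s • (p - q).2`, the derivative of the
  -- position difference is exactly the quantity bounded in `hsnd`.
  have hfst := norm_image_sub_le_of_norm_deriv_le_segment_01'
      (f := fun s => (β p s).1 - (β q s).1 - s • (p - q).2)
      (f' := fun s => (β p s).2 - (β q s).2 - (p - q).2) (C := ε * ‖p - q‖)
      (fun s hs => ?_) (fun s hs => hsnd s (Ico_subset_Icc_self hs))
  · simp only [(hβ p hpr).1, (hβ q hqr).1, one_smul, zero_smul, sub_zero] at hfst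
    have heq : (β p 1).1 - (β q 1).1 - (ContinuousLinearMap.fst ℝ V V +
        ContinuousLinearMap.snd ℝ V V) (p - q) =
        (β p 1).1 - (β q 1).1 - (p - q).2 - (p.1 - q.1) := by
      change _ - ((p.1 - q.1) + (p - q).2) = _
      abel
    exact heq ▸ hfst
  · refine ((ContinuousLinearMap.fst ℝ V V).hasFDerivAt.comp_hasDerivWithinAt s (hd s hs)).sub ?_
    simpa using ((hasDerivAt_id s).smul_const (p - q).2).hasDerivWithinAt

end Flow

/-! ### Charts of the tangent bundle -/

section TangentCharts

variable {n : ℕ} {M : Type*} [TopologicalSpace M] [ChartedSpace (EucR n) M] [IsC21Manifold n M]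

/-- The chart of the tangent bundle over the preferred chart at `p`. -/
noncomputable def tangentChart (n : ℕ) {M : Type*} [TopologicalSpace M] [ChartedSpace (EucR n) M]
    [IsC21Manifold n M] (p : M) :
    PartialEquiv (TangentBundle 𝓘(ℝ, EucR n) M) (EucR n × EucR n) :=
  extChartAt 𝓘(ℝ, EucR n).tangent (⟨p, 0⟩ : TangentBundle 𝓘(ℝ, EucR n) M)

theorem extChartAt_tangent (v : TangentBundle 𝓘(ℝ, EucR n) M) :
    extChartAt 𝓘(ℝ, EucR n).tangent v = tangentChart n v.proj := rfl

theorem mem_tangentChart_source {p : M} {v : TangentBundle 𝓘(ℝ, EucR n) M} :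
    v ∈ (tangentChart n p).source ↔ v.proj ∈ (chartAt (EucR n) p).source := by
  rw [tangentChart, extChartAt_source, TangentBundle.mem_chart_source_iff]

theorem mem_tangentChart_target {p : M} {z : EucR n × EucR n} :
    z ∈ (tangentChart n p).target ↔ z.1 ∈ (chartAt (EucR n) p).target := by
  rw [tangentChart, extChartAt]
  simp only [OpenPartialHomeomorph.extend, PartialEquiv.trans_target, mem_inter_iff, mem_preimage]
  refine (and_iff_right ?_).trans (TangentBundle.mem_chart_target_iff z _)
  exact ⟨mem_univ _, mem_univ _⟩

theorem tangentChart_symm_proj (p : M) (z : EucR n × EucR n) :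
    ((tangentChart n p).symm z).proj = (chartAt (EucR n) p).symm z.1 := rfl

/-- Reconciles the coordinates in which solutions are defined (through `mfderiv`) with the charts
that give the tangent bundle its manifold structure. -/
theorem tangentCoord_chartAt {p : M} {v : TangentBundle 𝓘(ℝ, EucR n) M}
    (hv : v ∈ (tangentChart n p).source) :
    tangentCoord n (chartAt (EucR n) p) v = tangentChart n p v := by
  rw [mem_tangentChart_source] at hv
  rw [tangentCoord, mfderiv_chartAt_eq_tangentCoordChange hv]
  rfl

theorem isOpen_tangentChart_source (p : M) : IsOpen (tangentChart n p).source :=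
  isOpen_extChartAt_source _

theorem continuousOn_tangentChart (p : M) :
    ContinuousOn (tangentChart n p) (tangentChart n p).source :=
  continuousOn_extChartAt _

theorem continuousOn_tangentChart_symm (p : M) :
    ContinuousOn (tangentChart n p).symm (tangentChart n p).target :=
  continuousOn_extChartAt_symm _

theorem contDiffOn_chart_change {e e' : OpenPartialHomeomorph M (EucR n)}
    (he : e ∈ atlas (EucR n) M) (he' : e' ∈ atlas (EucR n) M) :
    ContDiffOn ℝ 2 (e' ∘ e.symm) (e.symm ≫ₕ e').source := by
  have h := (contDiffGroupoid 2 𝓘(ℝ, EucR n)).compatible he he'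
  rw [contDiffGroupoid, mem_groupoid_of_pregroupoid] at h
  simpa [contDiffPregroupoid] using h.1

/-- The chain rule for `e' = (e' ∘ e.symm) ∘ e` near the base point. -/
theorem tangentCoord_change {e e' : OpenPartialHomeomorph M (EucR n)}
    (he : e ∈ atlas (EucR n) M) (he' : e' ∈ atlas (EucR n) M)
    {v : TangentBundle 𝓘(ℝ, EucR n) M} (hv : v.proj ∈ e.source) (hv' : v.proj ∈ e'.source) :
    tangentCoord n e' v = ((e' ∘ e.symm) (tangentCoord n e v).1,
      fderiv ℝ (e' ∘ e.symm) (tangentCoord n e v).1 (tangentCoord n e v).2) := by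
  have hx : e v.proj ∈ (e.symm ≫ₕ e').source := by
    simp [hv, hv']
  have hd : DifferentiableAt ℝ (e' ∘ e.symm) (e v.proj) :=
    ((contDiffOn_chart_change he he').contDiffAt
      ((e.symm ≫ₕ e').open_source.mem_nhds hx)).differentiableAt (by norm_num)
  have hm := mdifferentiableAt_atlas (I := 𝓘(ℝ, EucR n)) he hv
  have hcomp := mfderiv_comp v.proj hd.mdifferentiableAt hm
  have heq : e' =ᶠ[𝓝 v.proj] (e' ∘ e.symm) ∘ e := by
    filter_upwards [e.open_source.mem_nhds hv] with q hq
    simp [hq]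
  refine Prod.ext (by simp [tangentCoord, hv]) ?_
  change mfderiv 𝓘(ℝ, EucR n) 𝓘(ℝ, EucR n) e' v.proj v.snd = _
  rw [heq.mfderiv_eq, hcomp, mfderiv_eq_fderiv]
  rfl

end TangentCharts

/-! ### Solutions in the tangent bundle: change of charts and gluing -/

/-- The derivative of the image of a second order curve under a tangent map. -/
theorem ContDiffAt.hasDerivWithinAt_tangent_map {V : Type*} [NormedAddCommGroup V]
    [NormedSpace ℝ V] {τ : V → V} {z : ℝ → V × V} {J : Set ℝ} {t : ℝ} {w : V}
    (hτ : ContDiffAt ℝ 2 τ (z t).1) (hz : HasDerivWithinAt z ((z t).2, w) J t) :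
    HasDerivWithinAt (fun s => (τ (z s).1, fderiv ℝ τ (z s).1 (z s).2))
      (fderiv ℝ τ (z t).1 (z t).2,
        fderiv ℝ (fderiv ℝ τ) (z t).1 (z t).2 (z t).2 + fderiv ℝ τ (z t).1 w) J t := by
  have hτd : HasFDerivAt τ (fderiv ℝ τ (z t).1) (z t).1 :=
    (hτ.differentiableAt (by norm_num)).hasFDerivAt
  have hτd2 : HasFDerivAt (fderiv ℝ τ) (fderiv ℝ (fderiv ℝ τ) (z t).1) (z t).1 :=
    ((hτ.fderiv_right (m := 1) (by norm_num)).differentiableAt (by norm_num)).hasFDerivAt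
  have hfst : HasDerivWithinAt (fun s => (z s).1) (z t).2 J t :=
    (ContinuousLinearMap.fst ℝ V V).hasFDerivAt.comp_hasDerivWithinAt t hz
  have hsnd : HasDerivWithinAt (fun s => (z s).2) w J t :=
    (ContinuousLinearMap.snd ℝ V V).hasFDerivAt.comp_hasDerivWithinAt t hz
  have h1 : HasDerivWithinAt (fun s => τ (z s).1) (fderiv ℝ τ (z t).1 (z t).2) J t :=
    hτd.comp_hasDerivWithinAt t hfst
  have h2 : HasDerivWithinAt (fun s => fderiv ℝ τ (z s).1)
      (fderiv ℝ (fderiv ℝ τ) (z t).1 (z t).2) J t := hτd2.comp_hasDerivWithinAt t hfst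
  have h3 := h2.clm_apply hsnd
  exact h1.prodMk h3

namespace LipschitzSpray

variable {n : ℕ} {M : Type*} [TopologicalSpace M] [ChartedSpace (EucR n) M] [IsC21Manifold n M]

/-- The preferred chart at `p` as an element of the atlas. -/
def chart (n : ℕ) {M : Type*} [TopologicalSpace M] [ChartedSpace (EucR n) M] (p : M) :
    atlas (EucR n) M := ⟨chartAt (EucR n) p, chart_mem_atlas _ p⟩

/-- A solution of the system of the spray in one chart is a solution in the tangent bundle. -/
theorem isSolutionOn_tangentChart_symm (S : LipschitzSpray n M) (p : M)
    {z : ℝ → EucR n × EucR n} {J : Set ℝ} (hz : ∀ t ∈ J, (z t).1 ∈ (chartAt (EucR n) p).target)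
    (hd : ∀ t ∈ J, HasDerivWithinAt z ((z t).2, S.coeff (chart n p) (z t).1 (z t).2) J t) :
    S.IsSolutionOn (fun t => (tangentChart n p).symm (z t)) J := by
  have hzt : ∀ t ∈ J, z t ∈ (tangentChart n p).target := fun t ht =>
    mem_tangentChart_target.2 (hz t ht)
  refine ⟨(continuousOn_tangentChart_symm p).comp (HasDerivWithinAt.continuousOn hd) hzt,
    fun t ht e' he' => ?_⟩
  set τ : EucR n → EucR n := e'.1 ∘ (chartAt (EucR n) p).symm with hτ
  have hsrc : ∀ s ∈ J, (tangentChart n p).symm (z s) ∈ (tangentChart n p).source := fun s hs =>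
    (tangentChart n p).map_target (hzt s hs)
  have hcoord : ∀ s ∈ J, ((tangentChart n p).symm (z s)).proj ∈ e'.1.source →
      tangentCoord n e'.1 ((tangentChart n p).symm (z s)) =
        (τ (z s).1, fderiv ℝ τ (z s).1 (z s).2) := fun s hs hs' => by
    rw [tangentCoord_change (chart_mem_atlas _ p) e'.2 (mem_tangentChart_source.1 (hsrc s hs)) hs',
      tangentCoord_chartAt (hsrc s hs), (tangentChart n p).right_inv (hzt s hs)]
  have hx : (z t).1 ∈ ((chartAt (EucR n) p).symm ≫ₕ e'.1).source := by
    rw [OpenPartialHomeomorph.trans_source]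
    exact ⟨hz t ht, he'⟩
  have hopen := ((chartAt (EucR n) p).symm ≫ₕ e'.1).open_source
  have hC2 : ContDiffAt ℝ 2 τ (z t).1 :=
    (contDiffOn_chart_change (chart_mem_atlas _ p) e'.2).contDiffAt (hopen.mem_nhds hx)
  have h3 := hC2.hasDerivWithinAt_tangent_map (hd t ht)
  -- The second derivative term produced by differentiating the tangent map is precisely the
  -- inhomogeneous term in the transformation law of the spray.
  have htr : S.coeff e' (τ (z t).1) (fderiv ℝ τ (z t).1 (z t).2) =
      fderiv ℝ (fderiv ℝ τ) (z t).1 (z t).2 (z t).2 +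
        fderiv ℝ τ (z t).1 (S.coeff (chart n p) (z t).1 (z t).2) := S.transform (chart n p) e' (z t).1 hx (z t).2
  rw [← htr] at h3
  rw [hcoord t ht he']
  refine (h3.congr_of_eventuallyEq ?_ (hcoord t ht he'))
  have hev : ∀ᶠ s in 𝓝[J] t, (z s).1 ∈ ((chartAt (EucR n) p).symm ≫ₕ e'.1).source :=
    (continuous_fst.continuousAt.comp_continuousWithinAt
      (hd t ht).continuousWithinAt).eventually (hopen.mem_nhds hx)
  filter_upwards [hev, self_mem_nhdsWithin] with s hs hsJ
  refine hcoord s hsJ ?_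
  rw [OpenPartialHomeomorph.trans_source] at hs
  exact hs.2

theorem IsSolutionOn.mono {S : LipschitzSpray n M} {η : ℝ → TangentBundle 𝓘(ℝ, EucR n) M}
    {J J' : Set ℝ} (h : S.IsSolutionOn η J) (hJ : J' ⊆ J) : S.IsSolutionOn η J' :=
  ⟨h.1.mono hJ, fun t ht e he => (h.2 t (hJ ht) e he).mono hJ⟩

theorem IsSolutionOn.congr {S : LipschitzSpray n M} {η η' : ℝ → TangentBundle 𝓘(ℝ, EucR n) M}
    {J : Set ℝ} (h : S.IsSolutionOn η J) (hJ : EqOn η' η J) : S.IsSolutionOn η' J := by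
  refine ⟨h.1.congr hJ, fun t ht e he => ?_⟩
  rw [hJ ht] at he ⊢
  refine (h.2 t ht e he).congr (fun s hs => ?_) ?_
  · simp only [hJ hs]
  · simp only [hJ ht]

theorem IsSolutionOn.comp_sub {S : LipschitzSpray n M} {η : ℝ → TangentBundle 𝓘(ℝ, EucR n) M}
    {J J' : Set ℝ} (h : S.IsSolutionOn η J) (c : ℝ) (hJ : MapsTo (fun t => t - c) J' J) :
    S.IsSolutionOn (fun t => η (t - c)) J' := by
  refine ⟨h.1.comp (by fun_prop) hJ, fun t ht e he => ?_⟩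
  have h1 : HasDerivWithinAt (fun s : ℝ => s - c) 1 J' t :=
    ((hasDerivAt_id t).sub_const c).hasDerivWithinAt
  have h2 := (h.2 (t - c) (hJ ht) e he).scomp t h1 hJ
  rw [one_smul] at h2
  exact h2

theorem IsSolutionOn.union {S : LipschitzSpray n M} {η : ℝ → TangentBundle 𝓘(ℝ, EucR n) M}
    {J J' : Set ℝ} (h : S.IsSolutionOn η J) (h' : S.IsSolutionOn η J') (hJ : IsClosed J)
    (hJ' : IsClosed J') : S.IsSolutionOn η (J ∪ J') := by
  have key : ∀ {K : Set ℝ}, IsClosed K → S.IsSolutionOn η K → ∀ t, ∀ e : atlas (EucR n) M,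
      (η t).proj ∈ e.1.source → HasDerivWithinAt (fun s => tangentCoord n e.1 (η s))
      ((tangentCoord n e.1 (η t)).2,
        S.coeff e (tangentCoord n e.1 (η t)).1 (tangentCoord n e.1 (η t)).2) K t := by
    intro K hK hs t e he
    by_cases ht : t ∈ K
    · exact hs.2 t ht e he
    -- Off a closed set every vector is a derivative within it, so the two one-sided conditions can
    -- be united at all times.
    · exact HasFDerivWithinAt.of_notMem_closure (by rwa [hK.closure_eq])
  exact ⟨h.1.union_of_isClosed h'.1 hJ hJ', fun t _ e he =>
    (key hJ h t e he).union (key hJ' h' t e he)⟩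

/-- Concatenation of solutions. -/
theorem IsSolutionOn.exists_concat {S : LipschitzSpray n M}
    {η η' : ℝ → TangentBundle 𝓘(ℝ, EucR n) M} {a b : ℝ} (ha : 0 ≤ a) (hb : 0 ≤ b)
    (h : S.IsSolutionOn η (Icc 0 a)) (h' : S.IsSolutionOn η' (Icc 0 b)) (hη : η a = η' 0) :
    ∃ ζ : ℝ → TangentBundle 𝓘(ℝ, EucR n) M, ζ 0 = η 0 ∧ ζ (a + b) = η' b ∧
      S.IsSolutionOn ζ (Icc 0 (a + b)) := by
  classical
  let ζ : ℝ → TangentBundle 𝓘(ℝ, EucR n) M := fun t => if t ≤ a then η t else η' (t - a)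
  have h1 : EqOn ζ η (Icc 0 a) := fun t ht => if_pos ht.2
  have h2 : EqOn ζ (fun t => η' (t - a)) (Icc a (a + b)) := fun t ht => by
    rcases ht.1.eq_or_lt with rfl | hlt
    · simp [ζ, hη]
    · exact if_neg hlt.not_ge
  refine ⟨ζ, h1 ⟨le_rfl, ha⟩, by simpa using h2 ⟨by linarith, le_rfl⟩, ?_⟩
  rw [← Icc_union_Icc_eq_Icc ha (by linarith : a ≤ a + b)]
  refine (h.congr h1).union (IsSolutionOn.congr ?_ h2) isClosed_Icc isClosed_Icc
  exact h'.comp_sub a fun t ht => ⟨by linarith [ht.1], by linarith [ht.2]⟩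

end LipschitzSpray

/-! ### Uniqueness of solutions and the flow up to time one -/

section TangentBundle

variable {n : ℕ} {M : Type*} [TopologicalSpace M] [ChartedSpace (EucR n) M] [IsC21Manifold n M]

/-- Vectors over the same point are separated in a common chart, vectors over different points by
the projection. Needed so that two solutions coincide on a closed set of times. -/
theorem t2Space_tangentBundle [T2Space M] : T2Space (TangentBundle 𝓘(ℝ, EucR n) M) := by
  refine ⟨fun v w hvw => ?_⟩
  by_cases hp : v.proj = w.proj
  · have hv : v ∈ (tangentChart n v.proj).source :=
      mem_tangentChart_source.2 (mem_chart_source _ _)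
    have hw : w ∈ (tangentChart n v.proj).source :=
      mem_tangentChart_source.2 (hp ▸ mem_chart_source _ _)
    obtain ⟨A, B, hA, hB, hvA, hwB, hAB⟩ :=
      t2_separation ((tangentChart n v.proj).injOn.ne hv hw hvw)
    refine ⟨_, _, (continuousOn_tangentChart v.proj).isOpen_inter_preimage
      (isOpen_tangentChart_source _) hA, (continuousOn_tangentChart v.proj).isOpen_inter_preimage
      (isOpen_tangentChart_source _) hB, ⟨hv, hvA⟩, ⟨hw, hwB⟩, ?_⟩
    exact (hAB.preimage _).mono inter_subset_right inter_subset_right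
  · exact separated_by_continuous (FiberBundle.continuous_proj _ _) hp

end TangentBundle

namespace LipschitzSpray

theorem exists_lipschitzOnWith_coeff {n : ℕ} {M : Type*} [TopologicalSpace M]
    [ChartedSpace (EucR n) M] (S : LipschitzSpray n M) (p : M) {z : EucR n × EucR n}
    (hz : z.1 ∈ (chartAt (EucR n) p).target) :
    ∃ K : ℝ≥0, ∃ t ∈ 𝓝 z, LipschitzOnWith K
      (fun z : EucR n × EucR n => S.coeff (chart n p) z.1 z.2) t := by
  obtain ⟨K, t, ht, hK⟩ := S.locallyLipschitz (chart n p) (x := z) ⟨hz, mem_univ _⟩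
  refine ⟨K, t, ?_, hK⟩
  have hs : IsOpen ((chart n p).1.target ×ˢ (univ : Set (EucR n))) :=
    (chart n p).1.open_target.prod isOpen_univ
  rwa [hs.nhdsWithin_eq ⟨hz, mem_univ _⟩] at ht

theorem exists_lipschitzOnWith_field {n : ℕ} {M : Type*} [TopologicalSpace M]
    [ChartedSpace (EucR n) M] (S : LipschitzSpray n M) (p : M) {z : EucR n × EucR n}
    (hz : z.1 ∈ (chartAt (EucR n) p).target) :
    ∃ K : ℝ≥0, ∃ t ∈ 𝓝 z, LipschitzOnWith K
      (fun z : EucR n × EucR n => (z.2, S.coeff (chart n p) z.1 z.2)) t := by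
  obtain ⟨K, t, ht, hK⟩ := S.exists_lipschitzOnWith_coeff p hz
  exact ⟨_, t, ht, LipschitzWith.prod_snd.lipschitzOnWith.prodMk hK⟩

variable {n : ℕ} {M : Type*} [TopologicalSpace M] [ChartedSpace (EucR n) M] [IsC21Manifold n M]

theorem IsSolutionOn.hasDerivWithinAt_tangentChart {S : LipschitzSpray n M}
    {η : ℝ → TangentBundle 𝓘(ℝ, EucR n) M} {J : Set ℝ} (h : S.IsSolutionOn η J) {p : M} {t : ℝ}
    (ht : t ∈ J) (hp : η t ∈ (tangentChart n p).source) :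
    HasDerivWithinAt (fun s => tangentChart n p (η s))
      ((tangentChart n p (η t)).2,
        S.coeff (chart n p) (tangentChart n p (η t)).1 (tangentChart n p (η t)).2) J t := by
  have h1 := h.2 t ht (chart n p) (mem_tangentChart_source.1 hp)
  have h2 : tangentCoord n (chart n p).1 (η t) = tangentChart n p (η t) := tangentCoord_chartAt hp
  rw [h2] at h1
  refine h1.congr_of_eventuallyEq ?_ h2.symm
  filter_upwards [(h.1 t ht).eventually ((isOpen_tangentChart_source p).mem_nhds hp)] with s hs
  exact (tangentCoord_chartAt hs).symm

/-- Uniqueness of the solution with given initial velocity. -/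
theorem IsSolutionOn.eqOn [T2Space M] {S : LipschitzSpray n M}
    {η ζ : ℝ → TangentBundle 𝓘(ℝ, EucR n) M} {b : ℝ} (hη : S.IsSolutionOn η (Icc 0 b))
    (hζ : S.IsSolutionOn ζ (Icc 0 b)) (h0 : η 0 = ζ 0) : EqOn η ζ (Icc 0 b) := by
  have := t2Space_tangentBundle (n := n) (M := M)
  have hcl : IsClosed ({t | η t = ζ t} ∩ Icc 0 b) := by
    have := (hη.1.prodMk hζ.1).preimage_isClosed_of_isClosed isClosed_Icc
      (isClosed_diagonal (X := TangentBundle 𝓘(ℝ, EucR n) M))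
    rw [inter_comm]
    exact this
  -- Continuous induction: the coincidence set is closed, and uniqueness in one chart around a
  -- common value extends it to the right.
  refine hcl.Icc_subset_of_forall_mem_nhdsWithin h0 fun t ht => ?_
  obtain ⟨htE : η t = ζ t, ht0, htb⟩ := ht
  have htI : t ∈ Icc 0 b := ⟨ht0, htb.le⟩
  set p := (η t).proj
  have hp : η t ∈ (tangentChart n p).source := mem_tangentChart_source.2 (mem_chart_source _ _)
  have hp' : ζ t ∈ (tangentChart n p).source := htE ▸ hp
  obtain ⟨K, u, hu, hK⟩ := S.exists_lipschitzOnWith_field p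
    (mem_tangentChart_target.1 ((tangentChart n p).map_source hp))
  have hgood : ∀ {ξ : ℝ → TangentBundle 𝓘(ℝ, EucR n) M}, S.IsSolutionOn ξ (Icc 0 b) →
      ξ t = η t → ∀ᶠ s in 𝓝[Icc 0 b] t,
        ξ s ∈ (tangentChart n p).source ∧ tangentChart n p (ξ s) ∈ u := by
    intro ξ hξ hξt
    refine (hξ.1 t htI).eventually (p := fun w => w ∈ (tangentChart n p).source ∧
      tangentChart n p w ∈ u) ?_
    rw [hξt]
    refine ((isOpen_tangentChart_source p).eventually_mem hp).and ?_
    exact ((continuousOn_tangentChart p).continuousAt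
      ((isOpen_tangentChart_source p).mem_nhds hp)).eventually hu
  obtain ⟨ε, hε, hεs⟩ := Metric.mem_nhdsWithin_iff.1 ((hgood hη rfl).and (hgood hζ htE.symm))
  obtain ⟨c, htc, hcb, hcε⟩ : ∃ c, t < c ∧ c ≤ b ∧ c < t + ε := by
    refine ⟨min b (t + ε / 2), lt_min htb (by linarith), min_le_left _ _, ?_⟩
    exact (min_le_right _ _).trans_lt (by linarith)
  have hsub : ∀ s ∈ Icc t c, s ∈ Icc 0 b ∧
      ((η s ∈ (tangentChart n p).source ∧ tangentChart n p (η s) ∈ u) ∧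
        (ζ s ∈ (tangentChart n p).source ∧ tangentChart n p (ζ s) ∈ u)) := by
    intro s hs
    have hsI : s ∈ Icc 0 b := ⟨ht0.trans hs.1, hs.2.trans hcb⟩
    refine ⟨hsI, hεs ⟨?_, hsI⟩⟩
    rw [Metric.mem_ball, Real.dist_eq, abs_of_nonneg (by linarith [hs.1])]
    linarith [hs.2]
  have hIcc : Icc t c ⊆ Icc 0 b := fun s hs => (hsub s hs).1
  have hIci : ∀ s ∈ Ico t c, Icc 0 b ∈ 𝓝[≥] s := fun s hs =>
    Icc_mem_nhdsGE_of_mem ⟨ht0.trans hs.1, hs.2.trans_le hcb⟩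
  have key : EqOn (fun s => tangentChart n p (η s)) (fun s => tangentChart n p (ζ s)) (Icc t c) := by
    refine ODE_solution_unique_of_mem_Icc_right
      (v := fun _ z => (z.2, S.coeff (chart n p) z.1 z.2)) (s := fun _ => u) (fun _ _ => hK)
      ?_ ?_ (fun s hs => (hsub s (Ico_subset_Icc_self hs)).2.1.2)
      ?_ ?_ (fun s hs => (hsub s (Ico_subset_Icc_self hs)).2.2.2) (by simp only [htE])
    · exact fun s hs => ((hη.hasDerivWithinAt_tangentChart (hIcc hs)
        (hsub s hs).2.1.1).mono hIcc).continuousWithinAt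
    · exact fun s hs => (hη.hasDerivWithinAt_tangentChart (hIcc (Ico_subset_Icc_self hs))
        (hsub s (Ico_subset_Icc_self hs)).2.1.1).mono_of_mem_nhdsWithin (hIci s hs)
    · exact fun s hs => ((hζ.hasDerivWithinAt_tangentChart (hIcc hs)
        (hsub s hs).2.2.1).mono hIcc).continuousWithinAt
    · exact fun s hs => (hζ.hasDerivWithinAt_tangentChart (hIcc (Ico_subset_Icc_self hs))
        (hsub s (Ico_subset_Icc_self hs)).2.2.1).mono_of_mem_nhdsWithin (hIci s hs)
  filter_upwards [Ioo_mem_nhdsGT htc] with s hs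
  have hs' := Ioo_subset_Icc_self hs
  exact (tangentChart n p).injOn (hsub s hs').2.1.1 (hsub s hs').2.2.1 (key hs')

/-- The local flow on the tangent bundle. -/
theorem exists_local_flow (S : LipschitzSpray n M) (v : TangentBundle 𝓘(ℝ, EucR n) M) :
    ∃ δ > 0, ∃ W, IsOpen W ∧ v ∈ W ∧
      ∃ Φ : TangentBundle 𝓘(ℝ, EucR n) M → ℝ → TangentBundle 𝓘(ℝ, EucR n) M,
      ∀ w ∈ W, Φ w 0 = w ∧ S.IsSolutionOn (Φ w) (Icc 0 δ) ∧ ∀ s ∈ Icc 0 δ,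
        LipschitzAtInCharts 𝓘(ℝ, EucR n).tangent 𝓘(ℝ, EucR n).tangent (fun u => Φ u s) w := by
  set p := v.proj
  have hp : v ∈ (tangentChart n p).source := mem_tangentChart_source.2 (mem_chart_source _ _)
  have hpt := (tangentChart n p).map_source hp
  obtain ⟨K, t, ht, hK⟩ := S.exists_lipschitzOnWith_field p (mem_tangentChart_target.1 hpt)
  have hO : (tangentChart n p).target ∈ 𝓝 (tangentChart n p v) :=
    (isOpen_extChartAt_target _).mem_nhds hpt
  obtain ⟨δ, hδ, r, hr, L, α, hα, hL⟩ := hK.exists_local_flow ht hO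
  refine ⟨δ, hδ, (tangentChart n p).source ∩ tangentChart n p ⁻¹' Metric.ball (tangentChart n p v) r,
    ?_, ⟨hp, Metric.mem_ball_self hr⟩, fun w s => (tangentChart n p).symm (α (tangentChart n p w) s), ?_⟩
  · exact (continuousOn_tangentChart p).isOpen_inter_preimage (isOpen_tangentChart_source p)
      Metric.isOpen_ball
  · rintro w ⟨hw, hwr⟩
    obtain ⟨h0, h1⟩ := hα _ (Metric.ball_subset_closedBall hwr)
    refine ⟨?_, ?_, fun s hs => ?_⟩
    · simp only [h0, (tangentChart n p).left_inv hw]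
    · exact S.isSolutionOn_tangentChart_symm p
        (fun s hs => mem_tangentChart_target.1 (h1 s hs).1) fun s hs => (h1 s hs).2
    · have h2 : LipschitzAtInCharts 𝓘(ℝ, EucR n × EucR n) 𝓘(ℝ, EucR n × EucR n)
          (fun z => α z s) (tangentChart n p w) :=
        (hL s hs).lipschitzAtInCharts (mem_of_superset (Metric.isOpen_ball.mem_nhds hwr)
          Metric.ball_subset_closedBall)
      have h3 : LipschitzAtInCharts 𝓘(ℝ, EucR n).tangent 𝓘(ℝ, EucR n × EucR n)
          (tangentChart n p) w := lipschitzAtInCharts_extChartAt hw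
      have h4 : LipschitzAtInCharts 𝓘(ℝ, EucR n × EucR n) 𝓘(ℝ, EucR n).tangent
          (tangentChart n p).symm (α (tangentChart n p w) s) :=
        lipschitzAtInCharts_extChartAt_symm (h1 s hs).1
      exact LipschitzAtInCharts.comp (f := fun u => α (tangentChart n p u) s) h4
        (LipschitzAtInCharts.comp (g := fun z => α z s) h2 h3)

/-- Solutions on `[0, 1]` persist for nearby initial velocities, and their end point depends on the
initial velocity in a Lipschitz way. -/
theorem IsSolutionOn.exists_flow [T2Space M] {S : LipschitzSpray n M}
    {η : ℝ → TangentBundle 𝓘(ℝ, EucR n) M} (hη : S.IsSolutionOn η (Icc 0 1)) :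
    ∃ U ∈ 𝓝 (η 0), ∃ Φ : TangentBundle 𝓘(ℝ, EucR n) M → TangentBundle 𝓘(ℝ, EucR n) M,
      (∀ w ∈ U, ∃ ζ : ℝ → TangentBundle 𝓘(ℝ, EucR n) M, ζ 0 = w ∧ ζ 1 = Φ w ∧
        S.IsSolutionOn ζ (Icc 0 1)) ∧
      LipschitzAtInCharts 𝓘(ℝ, EucR n).tangent 𝓘(ℝ, EucR n).tangent Φ (η 0) := by
  choose δ hδ W hWo hW Ψ hΨ using S.exists_local_flow
  -- Compactness of `[0, 1]` gives one lower bound `d` for the life time of local flows defined near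
  -- the points of the curve.
  obtain ⟨d, hd, hdη⟩ : ∃ d > 0, ∀ t ∈ Icc (0 : ℝ) 1, ∃ v, η t ∈ W v ∧ d ≤ δ v := by
    refine isCompact_Icc.induction_on (p := fun s => ∃ d > 0, ∀ t ∈ s, ∃ v, η t ∈ W v ∧ d ≤ δ v)
      ⟨1, one_pos, by simp⟩ ?_ ?_ ?_
    · rintro s s' hs ⟨d, hd, h⟩
      exact ⟨d, hd, fun t ht => h t (hs ht)⟩
    · rintro s s' ⟨d, hd, h⟩ ⟨d', hd', h'⟩
      refine ⟨min d d', lt_min hd hd', ?_⟩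
      rintro t (ht | ht)
      · obtain ⟨v, hv, hvd⟩ := h t ht
        exact ⟨v, hv, (min_le_left _ _).trans hvd⟩
      · obtain ⟨v, hv, hvd⟩ := h' t ht
        exact ⟨v, hv, (min_le_right _ _).trans hvd⟩
    · intro t ht
      exact ⟨_, (hη.1 t ht) ((hWo _).mem_nhds (hW (η t))), δ (η t), hδ _, fun s hs => ⟨η t, hs, le_rfl⟩⟩
  obtain ⟨k, hk⟩ := exists_nat_one_div_lt hd
  set h : ℝ := 1 / ((k : ℝ) + 1) with hh
  have hh0 : 0 < h := by positivity
  have hhk : ((k + 1 : ℕ) : ℝ) * h = 1 := by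
    rw [hh]; push_cast; field_simp
  -- The flow up to time `i * h` is built by composing local flows; the step `h < d` is chosen with
  -- `(k + 1) * h = 1`, so that the last stage is time one.
  have main : ∀ i : ℕ, i ≤ k + 1 → ∃ U ∈ 𝓝 (η 0),
      ∃ Φ : TangentBundle 𝓘(ℝ, EucR n) M → TangentBundle 𝓘(ℝ, EucR n) M,
      (∀ w ∈ U, ∃ ζ : ℝ → TangentBundle 𝓘(ℝ, EucR n) M, ζ 0 = w ∧ ζ (i * h) = Φ w ∧
        S.IsSolutionOn ζ (Icc 0 (i * h))) ∧
      LipschitzAtInCharts 𝓘(ℝ, EucR n).tangent 𝓘(ℝ, EucR n).tangent Φ (η 0) := by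
    intro i
    induction i with
    | zero =>
      refine fun _ => ⟨univ, univ_mem, id, fun w _ => ⟨fun _ => w, rfl, rfl, continuousOn_const,
        fun t ht e he => ?_⟩, contMDiffAt_id.lipschitzAtInCharts⟩
      -- At stage zero the interval is a single point, where the derivative condition is void.
      have ht' : Icc (0 : ℝ) ((0 : ℕ) * h) = {t} := by
        simp only [Nat.cast_zero, zero_mul, Icc_self, mem_singleton_iff] at ht ⊢
        rw [ht]
      rw [ht']
      exact HasFDerivWithinAt.of_finite (finite_singleton t)
    | succ i ih =>
      intro hi
      obtain ⟨U, hU, Φ, hΦ, hΦl⟩ := ih (by omega)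
      have hi0 : 0 ≤ (i : ℝ) * h := by positivity
      have hi1 : (i : ℝ) * h ≤ 1 := by
        rw [← hhk]
        gcongr
        omega
      -- By uniqueness the flow constructed so far carries `η 0` along `η`, so the next local flow
      -- `Ψ v` is available there and, by continuity, nearby.
      have hΦ0 : Φ (η 0) = η (i * h) := by
        obtain ⟨ζ, hζ0, hζ1, hζ⟩ := hΦ _ (mem_of_mem_nhds hU)
        rw [← hζ1]
        exact hζ.eqOn (hη.mono (Icc_subset_Icc_right hi1)) hζ0 ⟨hi0, le_rfl⟩
      obtain ⟨v, hv, hvd⟩ := hdη _ ⟨hi0, hi1⟩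
      have hhI : h ∈ Icc 0 (δ v) := ⟨hh0.le, hk.le.trans hvd⟩
      have hUv : ∀ᶠ w in 𝓝 (η 0), Φ w ∈ W v :=
        hΦl.1.eventually ((hWo v).mem_nhds (hΦ0 ▸ hv))
      refine ⟨_, inter_mem hU hUv, fun w => Ψ v (Φ w) h, fun w hw => ?_, ?_⟩
      · obtain ⟨ζ, hζ0, hζ1, hζ⟩ := hΦ w hw.1
        obtain ⟨hΨ0, hΨs, -⟩ := hΨ v _ hw.2
        obtain ⟨ξ, hξ0, hξ1, hξ⟩ := hζ.exists_concat hi0 hh0.le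
          (hΨs.mono (Icc_subset_Icc_right hhI.2)) (hζ1.trans hΨ0.symm)
        have hsucc : ((i + 1 : ℕ) : ℝ) * h = i * h + h := by push_cast; ring
        rw [hsucc]
        exact ⟨ξ, hξ0.trans hζ0, hξ1, hξ⟩
      · exact LipschitzAtInCharts.comp (g := fun u => Ψ v u h)
          ((hΨ v _ (hΦ0 ▸ hv)).2.2 h hhI) hΦl
  obtain ⟨U, hU, Φ, hΦ, hΦl⟩ := main (k + 1) le_rfl
  rw [hhk] at hΦ
  exact ⟨U, hU, Φ, hΦ, hΦl⟩

/-- Uniqueness makes the choice inside `endpoint` immaterial. -/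
theorem endpoint_eq [T2Space M] {S : LipschitzSpray n M}
    {η : ℝ → TangentBundle 𝓘(ℝ, EucR n) M} (hη : S.IsSolutionOn η (Icc 0 1)) :
    S.endpoint (η 0) = (η 1).proj := by
  have h : η 0 ∈ S.expDomain := ⟨η, rfl, hη⟩
  rw [endpoint, dif_pos h]
  exact congrArg _ (h.choose_spec.2.eqOn hη h.choose_spec.1 ⟨zero_le_one, le_rfl⟩)

theorem exists_nhds_flow [T2Space M] {S : LipschitzSpray n M} {v : TangentBundle 𝓘(ℝ, EucR n) M}
    (hv : v ∈ S.expDomain) : S.expDomain ∈ 𝓝 v ∧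
    LipschitzAtInCharts 𝓘(ℝ, EucR n).tangent 𝓘(ℝ, EucR n) S.endpoint v := by
  obtain ⟨η, rfl, hη⟩ := hv
  obtain ⟨U, hU, Φ, hΦ, hΦl⟩ := hη.exists_flow
  refine ⟨?_, ?_⟩
  · filter_upwards [hU] with w hw
    obtain ⟨ζ, hζ0, -, hζ⟩ := hΦ w hw
    exact ⟨ζ, hζ0, hζ⟩
  · have h1 : LipschitzAtInCharts 𝓘(ℝ, EucR n).tangent 𝓘(ℝ, EucR n)
        (Bundle.TotalSpace.proj : TangentBundle 𝓘(ℝ, EucR n) M → M) (Φ (η 0)) :=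
      (Bundle.contMDiffAt_proj _).lipschitzAtInCharts
    refine (h1.comp hΦl).congr ?_
    filter_upwards [hU] with w hw
    obtain ⟨ζ, rfl, hζ1, hζ⟩ := hΦ w hw
    rw [endpoint_eq hζ, hζ1]
    rfl

theorem isOpen_expDomain [T2Space M] (S : LipschitzSpray n M) : IsOpen S.expDomain :=
  isOpen_iff_mem_nhds.2 fun _ hv => (exists_nhds_flow hv).1

theorem lipschitzAtInCharts_endpoint [T2Space M] {S : LipschitzSpray n M}
    {v : TangentBundle 𝓘(ℝ, EucR n) M} (hv : v ∈ S.expDomain) :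
    LipschitzAtInCharts 𝓘(ℝ, EucR n).tangent 𝓘(ℝ, EucR n) S.endpoint v :=
  (exists_nhds_flow hv).2

theorem lipschitzAtInCharts_exp [T2Space M] {S : LipschitzSpray n M}
    {v : TangentBundle 𝓘(ℝ, EucR n) M} (hv : v ∈ S.expDomain) :
    LipschitzAtInCharts 𝓘(ℝ, EucR n).tangent (𝓘(ℝ, EucR n).prod 𝓘(ℝ, EucR n)) S.exp v := by
  have h1 : LipschitzAtInCharts 𝓘(ℝ, EucR n).tangent 𝓘(ℝ, EucR n)
      (Bundle.TotalSpace.proj : TangentBundle 𝓘(ℝ, EucR n) M → M) v :=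
    (Bundle.contMDiffAt_proj _).lipschitzAtInCharts
  exact h1.prodMk (lipschitzAtInCharts_endpoint hv)

end LipschitzSpray

/-! ### Tangent charts on fibres and along the zero section -/

section TangentChartLinear

variable {n : ℕ} {M : Type*} [TopologicalSpace M] [ChartedSpace (EucR n) M] [IsC21Manifold n M]

theorem tangentChart_smul {p q : M} (hq : q ∈ (chartAt (EucR n) p).source)
    (u : TangentSpace 𝓘(ℝ, EucR n) q) (s : ℝ) :
    (tangentChart n p ⟨q, s • u⟩).2 = s • (tangentChart n p ⟨q, u⟩).2 := by
  rw [← tangentCoord_chartAt (mem_tangentChart_source.2 hq),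
    ← tangentCoord_chartAt (mem_tangentChart_source.2 hq)]
  exact map_smul (mfderiv 𝓘(ℝ, EucR n) 𝓘(ℝ, EucR n) (chartAt (EucR n) p) q) s u

theorem tangentChart_zero {p q : M} (hq : q ∈ (chartAt (EucR n) p).source) :
    tangentChart n p ⟨q, 0⟩ = (chartAt (EucR n) p q, 0) := by
  refine Prod.ext rfl ?_
  have h := tangentChart_smul hq 0 0
  rwa [zero_smul, zero_smul] at h

theorem tangentChart_self (p : M) (v : EucR n) :
    tangentChart n p (⟨p, v⟩ : TangentBundle 𝓘(ℝ, EucR n) M) = (chartAt (EucR n) p p, v) :=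
  Prod.ext rfl (tangentCoordChange_self (I := 𝓘(ℝ, EucR n)) (mem_extChartAt_source p))

theorem extChartAt_tangent_zero (p : M) :
    extChartAt 𝓘(ℝ, EucR n).tangent (⟨p, 0⟩ : TangentBundle 𝓘(ℝ, EucR n) M) ⟨p, 0⟩ =
      (chartAt (EucR n) p p, 0) := tangentChart_self p 0

theorem tangentChart_symm_self (p : M) (v : EucR n) :
    (tangentChart n p).symm (chartAt (EucR n) p p, v) =
      (⟨p, v⟩ : TangentBundle 𝓘(ℝ, EucR n) M) := by
  rw [← tangentChart_self, (tangentChart n p).left_inv]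
  exact mem_tangentChart_source.2 (mem_chart_source _ _)

/-- In the tangent chart at `p` the inclusion of the fibre is `v ↦ (x₀, v)`. It transfers openness
and the Lipschitz property from `exp` to `exp_p`. -/
theorem lipschitzAtInCharts_fibre_inclusion (p : M) (v : EucR n) :
    LipschitzAtInCharts 𝓘(ℝ, EucR n) 𝓘(ℝ, EucR n).tangent
      (fun v : EucR n => (⟨p, v⟩ : TangentBundle 𝓘(ℝ, EucR n) M)) v := by
  have h1 : LipschitzAtInCharts 𝓘(ℝ, EucR n) 𝓘(ℝ, EucR n × EucR n)
      (fun v : EucR n => (chartAt (EucR n) p p, v)) v :=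
    ((LipschitzWith.prodMk_left (chartAt (EucR n) p p)).lipschitzOnWith
      (s := univ)).lipschitzAtInCharts univ_mem
  have h2 : LipschitzAtInCharts 𝓘(ℝ, EucR n × EucR n) 𝓘(ℝ, EucR n).tangent
      (tangentChart n p).symm (chartAt (EucR n) p p, v) :=
    lipschitzAtInCharts_extChartAt_symm (mem_tangentChart_target.2 (mem_chart_target _ p))
  refine (h2.comp h1).congr (.of_forall fun w => ?_)
  exact (tangentChart_symm_self p w).symm

end TangentChartLinear

/-! ### The exponential map near the zero section -/

namespace LipschitzSpray

/-- Homogeneity with factor `2` gives `H = 4 H` at zero velocity. -/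
theorem coeff_zero {n : ℕ} {M : Type*} [TopologicalSpace M] [ChartedSpace (EucR n) M]
    (S : LipschitzSpray n M) (e : atlas (EucR n) M) {x : EucR n}
    (hx : x ∈ e.1.target) : S.coeff e x 0 = 0 := by
  have h := S.homogeneous e x hx 0 2 (by norm_num)
  rw [smul_zero] at h
  have h' : (3 : ℝ) • S.coeff e x 0 = 0 := by
    have : (3 : ℝ) • S.coeff e x 0 = (2 : ℝ) ^ 2 • S.coeff e x 0 - S.coeff e x 0 := by
      module
    rw [this, ← h, sub_self]
  simpa using h'

variable {n : ℕ} {M : Type*} [TopologicalSpace M] [ChartedSpace (EucR n) M] [IsC21Manifold n M]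

theorem isSolutionOn_const_zero (S : LipschitzSpray n M) (p : M) (J : Set ℝ) :
    S.IsSolutionOn (fun _ => (⟨p, 0⟩ : TangentBundle 𝓘(ℝ, EucR n) M)) J := by
  have h := S.isSolutionOn_tangentChart_symm p (z := fun _ => (chartAt (EucR n) p p, 0)) (J := J)
    (fun _ _ => mem_chart_target _ p) fun t _ => by
      rw [S.coeff_zero (chart n p) (mem_chart_target _ p)]
      exact hasDerivWithinAt_const _ _ _
  exact h.congr fun t _ => (tangentChart_symm_self p 0).symm

theorem zero_mem_expDomain (S : LipschitzSpray n M) (p : M) :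
    (⟨p, 0⟩ : TangentBundle 𝓘(ℝ, EucR n) M) ∈ S.expDomain :=
  ⟨_, rfl, S.isSolutionOn_const_zero p _⟩

variable [T2Space M]

theorem exp_zero (S : LipschitzSpray n M) (p : M) :
    S.exp (⟨p, 0⟩ : TangentBundle 𝓘(ℝ, EucR n) M) = (p, p) :=
  Prod.ext rfl (endpoint_eq (S.isSolutionOn_const_zero p _))

/-- The differential of the exponential map at the zero section, in the preferred charts. -/
def expDifferential (V : Type*) [NormedAddCommGroup V] [NormedSpace ℝ V] :
    (V × V) ≃L[ℝ] V × V :=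
  ContinuousLinearEquiv.equivOfInverse
    ((ContinuousLinearMap.fst ℝ V V).prod
      (ContinuousLinearMap.fst ℝ V V + ContinuousLinearMap.snd ℝ V V))
    ((ContinuousLinearMap.fst ℝ V V).prod
      (ContinuousLinearMap.snd ℝ V V - ContinuousLinearMap.fst ℝ V V))
    (fun z => Prod.ext rfl (add_sub_cancel_left z.1 z.2))
    (fun z => Prod.ext rfl (add_sub_cancel z.1 z.2))

/-- The flow `β` stays over the chart target up to time one, so it lifts to true solutions, and in
charts `exp` becomes `z ↦ (z.1, (β z 1).1)` near the zero vector. -/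
theorem hasStrictFDerivAt_exp (S : LipschitzSpray n M) (p : M) :
    HasStrictFDerivAt (writtenInExtChartAt 𝓘(ℝ, EucR n).tangent (𝓘(ℝ, EucR n).prod 𝓘(ℝ, EucR n))
        (⟨p, 0⟩ : TangentBundle 𝓘(ℝ, EucR n) M) S.exp)
      (expDifferential (EucR n) : EucR n × EucR n →L[ℝ] EucR n × EucR n)
      (extChartAt 𝓘(ℝ, EucR n).tangent (⟨p, 0⟩ : TangentBundle 𝓘(ℝ, EucR n) M) ⟨p, 0⟩) := by
  have hx := mem_chart_target (EucR n) p
  have htarget := (chartAt (EucR n) p).open_target.mem_nhds hx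
  rw [extChartAt_tangent_zero]
  obtain ⟨K, t, ht, hK⟩ := S.exists_lipschitzOnWith_coeff p (z := (chartAt (EucR n) p p, 0)) hx
  obtain ⟨β, hβ, hβd⟩ := exists_spray_flow_hasStrictFDerivAt (O := (chartAt (EucR n) p).target ×ˢ univ)
    htarget (fun x hx v s hs => S.homogeneous (chart n p) x hx v s hs) ht hK
    (prod_mem_nhds htarget univ_mem)
  have h1 : HasStrictFDerivAt (fun z : EucR n × EucR n => (z.1, (β z 1).1))
      (expDifferential (EucR n) : EucR n × EucR n →L[ℝ] EucR n × EucR n)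
      (chartAt (EucR n) p p, 0) := hasStrictFDerivAt_fst.prodMk hβd
  refine h1.congr_of_eventuallyEq ?_
  filter_upwards [hβ, prod_mem_nhds htarget univ_mem] with z hz hzt
  have hsol := S.isSolutionOn_tangentChart_symm p (z := β z) (J := Icc 0 1)
    (fun s hs => (hz.2 s hs).1.1) fun s hs => (hz.2 s hs).2
  have hend := endpoint_eq hsol
  simp only [hz.1, tangentChart_symm_proj] at hend
  have hexp : S.exp ((tangentChart n p).symm z) =
      ((chartAt (EucR n) p).symm z.1, (chartAt (EucR n) p).symm (β z 1).1) := Prod.ext rfl hend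
  have h2 : (β z 1).1 ∈ (chartAt (EucR n) p).target := (hz.2 1 ⟨zero_le_one, le_rfl⟩).1.1
  simp only [writtenInExtChartAt, Function.comp_apply, exp_zero, extChartAt_tangent, hexp,
    extChartAt_prod]
  simp [(chartAt (EucR n) p).right_inv h2, (chartAt (EucR n) p).right_inv hzt.1]

theorem stronglyDifferentiableInCharts_exp (S : LipschitzSpray n M) (p : M) :
    StronglyDifferentiableInCharts 𝓘(ℝ, EucR n).tangent (𝓘(ℝ, EucR n).prod 𝓘(ℝ, EucR n)) S.exp
      (⟨p, 0⟩ : TangentBundle 𝓘(ℝ, EucR n) M) :=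
  ⟨(lipschitzAtInCharts_exp (S.zero_mem_expDomain p)).1, _, S.hasStrictFDerivAt_exp p⟩

theorem expAt_zero (S : LipschitzSpray n M) (p : M) : S.expAt p 0 = p :=
  congrArg Prod.snd (S.exp_zero p)

theorem lipschitzAtInCharts_expAt {S : LipschitzSpray n M} {p : M} {v : EucR n}
    (hv : v ∈ S.expAtDomain p) :
    LipschitzAtInCharts 𝓘(ℝ, EucR n) 𝓘(ℝ, EucR n) (S.expAt p) v :=
  LipschitzAtInCharts.comp (g := S.endpoint)
    (f := fun v : EucR n => (⟨p, v⟩ : TangentBundle 𝓘(ℝ, EucR n) M))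
    (lipschitzAtInCharts_endpoint hv) (lipschitzAtInCharts_fibre_inclusion p v)

theorem isOpen_expAtDomain (S : LipschitzSpray n M) (p : M) : IsOpen (S.expAtDomain p) :=
  S.isOpen_expDomain.preimage
    (continuous_iff_continuousAt.2 fun v => (lipschitzAtInCharts_fibre_inclusion p v).1)

theorem hasStrictFDerivAt_expAt (S : LipschitzSpray n M) (p : M) :
    HasStrictFDerivAt (writtenInExtChartAt 𝓘(ℝ, EucR n) 𝓘(ℝ, EucR n) (0 : EucR n) (S.expAt p))
      (ContinuousLinearEquiv.refl ℝ (EucR n) : EucR n →L[ℝ] EucR n)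
      (extChartAt 𝓘(ℝ, EucR n) (0 : EucR n) 0) := by
  have h1 := S.hasStrictFDerivAt_exp p
  rw [extChartAt_tangent_zero] at h1
  have h2 : HasStrictFDerivAt (fun v : EucR n => (chartAt (EucR n) p p, v))
      (ContinuousLinearMap.inr ℝ (EucR n) (EucR n)) 0 := 
    (hasStrictFDerivAt_const _ _).prodMk (hasStrictFDerivAt_id _)
  -- In charts `exp_p` is `exp` preceded by the inclusion of the fibre and followed by the second
  -- projection; the differential is `v ↦ 0 + v`.
  have h3 := (hasStrictFDerivAt_snd.comp _ h1).comp (0 : EucR n) h2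
  rw [ext_chart_model_space_apply]
  refine (h3.congr_of_eventuallyEq (.of_forall fun v => ?_)).congr_fderiv ?_
  · simp only [writtenInExtChartAt, Function.comp_apply, exp_zero, extChartAt_tangent,
      extChartAt_prod, expAt_zero, tangentChart_symm_self, extChartAt_model_space_eq_id]
    rfl
  · ext v : 1
    change (0 : EucR n) + v = v
    exact zero_add v

theorem stronglyDifferentiableInCharts_expAt (S : LipschitzSpray n M) (p : M) :
    StronglyDifferentiableInCharts 𝓘(ℝ, EucR n) 𝓘(ℝ, EucR n) (S.expAt p) 0 :=
  ⟨(lipschitzAtInCharts_expAt (S.zero_mem_expDomain p)).1, _, S.hasStrictFDerivAt_expAt p⟩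

theorem exists_isLipeomorphismOn_expAt (S : LipschitzSpray n M) (p : M) :
    ∃ (N : Set (EucR n)) (U : Set M),
      IsOpen N ∧ N ⊆ S.expAtDomain p ∧ (0 : EucR n) ∈ N ∧ StarConvex ℝ 0 N ∧
      IsOpen U ∧ p ∈ U ∧
      IsLipeomorphismOn 𝓘(ℝ, EucR n) 𝓘(ℝ, EucR n) (S.expAt p) N U := by
  obtain ⟨φ, h0, hφ, hφl⟩ := exists_openPartialHomeomorph_of_hasStrictFDerivAt
    (ContinuousLinearEquiv.refl ℝ (EucR n)) (S.stronglyDifferentiableInCharts_expAt p).1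
    (S.hasStrictFDerivAt_expAt p)
  -- A ball is taken as the domain because it is star-shaped.
  obtain ⟨r, hr, hrs⟩ := Metric.mem_nhds_iff.1 (inter_mem (φ.open_source.mem_nhds h0)
    ((S.isOpen_expAtDomain p).mem_nhds (S.zero_mem_expDomain p)))
  have h0r : (0 : EucR n) ∈ Metric.ball (0 : EucR n) r := Metric.mem_ball_self hr
  obtain ⟨hUo, hU⟩ := isLipeomorphismOn_image_of_injOn (f := S.expAt p) Metric.isOpen_ball
    ((φ.injOn.congr hφ).mono fun v hv => (hrs hv).1)
    (fun v hv => lipschitzAtInCharts_expAt (hrs hv).2)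
    fun v hv => ⟨φ, (hrs hv).1, hφ, hφl⟩
  exact ⟨_, _, Metric.isOpen_ball, fun v hv => (hrs hv).2, h0r,
    (convex_ball _ _).starConvex h0r, hUo, ⟨0, h0r, S.expAt_zero p⟩, hU⟩

/-! ### Patching local inverses of the exponential map -/

/-- Over a neighbourhood of each point, the exponential map restricts to a homeomorphism on a
neighbourhood of the zero section which is star-shaped in the fibres. -/
theorem exists_local_starShaped (S : LipschitzSpray n M) (p : M) :
    ∃ (O : Set M) (G : Set (TangentBundle 𝓘(ℝ, EucR n) M))
      (φ : OpenPartialHomeomorph (TangentBundle 𝓘(ℝ, EucR n) M) (M × M)),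
      IsOpen O ∧ p ∈ O ∧ IsOpen G ∧ G ⊆ S.expDomain ∧ G ⊆ φ.source ∧ EqOn φ S.exp φ.source ∧
      (∀ y ∈ φ.target, LipschitzAtInCharts (𝓘(ℝ, EucR n).prod 𝓘(ℝ, EucR n))
        𝓘(ℝ, EucR n).tangent φ.symm y) ∧
      (∀ q ∈ O, (⟨q, 0⟩ : TangentBundle 𝓘(ℝ, EucR n) M) ∈ G) ∧
      ∀ v ∈ G, ∀ s ∈ Icc (0 : ℝ) 1,
        (⟨v.proj, s • v.snd⟩ : TangentBundle 𝓘(ℝ, EucR n) M) ∈ G := by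
  obtain ⟨φ, h0, hφ, hφl⟩ := exists_openPartialHomeomorph_of_hasStrictFDerivAt
    (expDifferential (EucR n)) (S.stronglyDifferentiableInCharts_exp p).1
    (S.hasStrictFDerivAt_exp p)
  have hp : (chartAt (EucR n) p p, (0 : EucR n)) ∈ (tangentChart n p).target :=
    mem_tangentChart_target.2 (mem_chart_target _ p)
  have hpre : (tangentChart n p).symm ⁻¹' (φ.source ∩ S.expDomain) ∈
      𝓝 (chartAt (EucR n) p p, (0 : EucR n)) := by
    refine ((continuousOn_tangentChart_symm p).continuousAt
      ((isOpen_extChartAt_target _).mem_nhds hp)).preimage_mem_nhds ?_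
    rw [tangentChart_symm_self]
    exact inter_mem (φ.open_source.mem_nhds h0)
      (S.isOpen_expDomain.mem_nhds (S.zero_mem_expDomain p))
  -- In the chart, a product of balls is star-shaped in the second factor, and tangent charts are
  -- linear on fibres.
  obtain ⟨r, hr, hrs⟩ := Metric.mem_nhds_iff.1 hpre
  rw [← ball_prod_same] at hrs
  refine ⟨(chartAt (EucR n) p).source ∩ chartAt (EucR n) p ⁻¹' Metric.ball (chartAt (EucR n) p p) r,
    (tangentChart n p).source ∩ tangentChart n p ⁻¹'
      (Metric.ball (chartAt (EucR n) p p) r ×ˢ Metric.ball 0 r), φ,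
    (chartAt (EucR n) p).isOpen_inter_preimage Metric.isOpen_ball,
    ⟨mem_chart_source _ p, Metric.mem_ball_self hr⟩,
    (continuousOn_tangentChart p).isOpen_inter_preimage (isOpen_tangentChart_source p)
      (Metric.isOpen_ball.prod Metric.isOpen_ball), ?_, ?_, hφ, hφl, ?_, ?_⟩
  · intro v hv
    have h := (hrs hv.2).2
    rwa [(tangentChart n p).left_inv hv.1] at h
  · intro v hv
    have h := (hrs hv.2).1
    rwa [(tangentChart n p).left_inv hv.1] at h
  · rintro q ⟨hq, hqr⟩
    refine ⟨mem_tangentChart_source.2 hq, ?_⟩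
    rw [mem_preimage, tangentChart_zero hq]
    exact ⟨hqr, Metric.mem_ball_self hr⟩
  · rintro v ⟨hv, hvr⟩ s hs
    have hq := mem_tangentChart_source.1 hv
    refine ⟨mem_tangentChart_source.2 hq, hvr.1, ?_⟩
    have h := hvr.2
    rw [tangentChart_smul hq v.snd s]
    rw [mem_ball_zero_iff] at h ⊢
    rw [norm_smul, Real.norm_of_nonneg hs.1]
    refine lt_of_le_of_lt ?_ h
    exact mul_le_of_le_one_left (norm_nonneg _) hs.2

theorem exists_isLipeomorphismOn_exp [ParacompactSpace M] [Nonempty M] (S : LipschitzSpray n M) :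
    ∃ (N : Set (TangentBundle 𝓘(ℝ, EucR n) M)) (D : Set (M × M)),
      IsOpen N ∧ N ⊆ S.expDomain ∧
      (∀ p : M, (⟨p, 0⟩ : TangentBundle 𝓘(ℝ, EucR n) M) ∈ N) ∧
      (∀ v ∈ N, ∀ s ∈ Icc (0 : ℝ) 1,
        (⟨v.proj, s • v.snd⟩ : TangentBundle 𝓘(ℝ, EucR n) M) ∈ N) ∧
      IsOpen D ∧ (∀ p : M, (p, p) ∈ D) ∧
      IsLipeomorphismOn 𝓘(ℝ, EucR n).tangent (𝓘(ℝ, EucR n).prod 𝓘(ℝ, EucR n)) S.exp N D := by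
  choose O G φ hO hpO hG hGdom hGφ hφ hφl hGzero hGstar using S.exists_local_starShaped
  obtain ⟨u, huo, huc, hulf, huO⟩ := precise_refinement O hO
    (iUnion_eq_univ_iff.2 fun p => ⟨p, hpO p⟩)
  obtain ⟨C, hCc, hCcl, hCu⟩ := exists_iUnion_eq_closed_subset huo
    (fun x => hulf.point_finite x) huc
  let π : TangentBundle 𝓘(ℝ, EucR n) M → M := Bundle.TotalSpace.proj
  have hπ : Continuous π := FiberBundle.continuous_proj _ _
  -- All indices `i` with base point in `C i` are required, not just one: two vectors of `N` over
  -- the same point then lie in a common `G i`, where `exp` is injective.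
  let N : Set (TangentBundle 𝓘(ℝ, EucR n) M) := {v | ∀ i, π v ∈ C i → v ∈ G i}
  have hcov : ∀ q : M, ∃ i, q ∈ C i := iUnion_eq_univ_iff.1 hCc
  have hNopen : IsOpen N := by
    -- The complement of `N` is a locally finite union of closed sets; this is why the cover is
    -- shrunk to closed `C i`.
    have hcl : IsClosed (⋃ i, π ⁻¹' C i ∩ (G i)ᶜ) := by
      refine LocallyFinite.isClosed_iUnion ?_ fun i =>
        ((hCcl i).preimage hπ).inter (hG i).isClosed_compl
      exact ((hulf.subset hCu).preimage_continuous hπ).subset fun i => inter_subset_left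
    convert hcl.isOpen_compl using 1
    ext v
    simp [N]
  have hNG : ∀ v ∈ N, ∃ i, π v ∈ C i ∧ v ∈ G i := fun v hv =>
    (hcov (π v)).imp fun i hi => ⟨hi, hv i hi⟩
  have hNdom : N ⊆ S.expDomain := fun v hv => by
    obtain ⟨i, -, hi⟩ := hNG v hv
    exact hGdom i hi
  have hNzero : ∀ p : M, (⟨p, 0⟩ : TangentBundle 𝓘(ℝ, EucR n) M) ∈ N := fun p i hi =>
    hGzero i p (huO i (hCu i hi))
  have hinj : InjOn S.exp N := by
    intro v hv w hw hvw
    have hπvw : π v = π w := congrArg Prod.fst hvw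
    obtain ⟨i, hi, hvi⟩ := hNG v hv
    have hwi : w ∈ G i := hw i (hπvw ▸ hi)
    refine (φ i).injOn (hGφ i hvi) (hGφ i hwi) ?_
    rw [hφ i (hGφ i hvi), hφ i (hGφ i hwi), hvw]
  have : Nonempty (TangentBundle 𝓘(ℝ, EucR n) M) := ⟨⟨Classical.arbitrary M, 0⟩⟩
  obtain ⟨hD, hlip⟩ := isLipeomorphismOn_image_of_injOn hNopen hinj
    (fun v hv => lipschitzAtInCharts_exp (hNdom hv)) fun v hv => by
      obtain ⟨i, -, hi⟩ := hNG v hv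
      exact ⟨φ i, hGφ i hi, hφ i, hφl i⟩
  exact ⟨N, _, hNopen, hNdom, hNzero, fun v hv s hs i hi => hGstar i v (hv i hi) s hs, hD,
    fun p => ⟨_, hNzero p, S.exp_zero p⟩, hlip⟩

end LipschitzSpray

theorem theorem2 (n : ℕ) (M : Type*) [TopologicalSpace M] [T2Space M] [ParacompactSpace M]
    [ConnectedSpace M] [ChartedSpace (EucR n) M] [IsC21Manifold n M] (S : LipschitzSpray n M) :
    -- the exponential map
    (IsOpen S.expDomain ∧
      LocallyLipschitzInCharts 𝓘(ℝ, EucR n).tangent (𝓘(ℝ, EucR n).prod 𝓘(ℝ, EucR n))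
        S.exp S.expDomain ∧
      (∀ p : M, StronglyDifferentiableInCharts 𝓘(ℝ, EucR n).tangent
        (𝓘(ℝ, EucR n).prod 𝓘(ℝ, EucR n)) S.exp
        (⟨p, 0⟩ : TangentBundle 𝓘(ℝ, EucR n) M)) ∧
      ∃ (N : Set (TangentBundle 𝓘(ℝ, EucR n) M)) (D : Set (M × M)),
        IsOpen N ∧ N ⊆ S.expDomain ∧
        (∀ p : M, (⟨p, 0⟩ : TangentBundle 𝓘(ℝ, EucR n) M) ∈ N) ∧
        (∀ v ∈ N, ∀ s ∈ Icc (0 : ℝ) 1,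
          (⟨v.proj, s • v.snd⟩ : TangentBundle 𝓘(ℝ, EucR n) M) ∈ N) ∧
        IsOpen D ∧ (∀ p : M, (p, p) ∈ D) ∧
        IsLipeomorphismOn 𝓘(ℝ, EucR n).tangent (𝓘(ℝ, EucR n).prod 𝓘(ℝ, EucR n)) S.exp N D) ∧
    -- the pointed exponential maps
    (∀ p : M,
      IsOpen (S.expAtDomain p) ∧
      LocallyLipschitzInCharts 𝓘(ℝ, EucR n) 𝓘(ℝ, EucR n) (S.expAt p) (S.expAtDomain p) ∧
      StronglyDifferentiableInCharts 𝓘(ℝ, EucR n) 𝓘(ℝ, EucR n) (S.expAt p) 0 ∧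
      ∃ (N : Set (EucR n)) (U : Set M),
        IsOpen N ∧ N ⊆ S.expAtDomain p ∧ (0 : EucR n) ∈ N ∧ StarConvex ℝ 0 N ∧
        IsOpen U ∧ p ∈ U ∧
        IsLipeomorphismOn 𝓘(ℝ, EucR n) 𝓘(ℝ, EucR n) (S.expAt p) N U) := by
  exact ⟨⟨S.isOpen_expDomain,
      locallyLipschitzInCharts_of_forall fun _ hv => LipschitzSpray.lipschitzAtInCharts_exp hv,
      S.stronglyDifferentiableInCharts_exp, S.exists_isLipeomorphismOn_exp⟩,
    fun p => ⟨S.isOpen_expAtDomain p,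
      locallyLipschitzInCharts_of_forall fun _ hv => LipschitzSpray.lipschitzAtInCharts_expAt hv,
      S.stronglyDifferentiableInCharts_expAt p, S.exists_isLipeomorphismOn_expAt p⟩⟩
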